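/- **Setting.** Let $K\subseteq\mathbb R^n$ be a convex set containing the nonnegative orthant $\mathbb R^n_+$ (typically $K=\mathbb R^n_+$ or $K=\mathbb R^n$), and let $f:K\to\mathbb R$ be nonnegative, coordinatewise non-decreasing, convex and differentiable (relative to $K$), with $f(0)=0$ and $\nabla f(z)\ge\nabla f(z')$ whenever $z\ge z'$ in $K$. Let $f^\star(\mu)=\sup_{z\in K}\{\mu^{\mathsf T}z-f(z)\}$. For a nonnegative $m\times n$ matrix $A=(a_{tj})$ with no zero row consider $$(P)\ \min\{f(x): Ax\ge \mathbf 1,\ x\ge 0\},\qquad (D)\ \max\Big\{\sum_{i=1}^m y_i-f^\star(\mu): A^{\mathsf T}y\le\mu,\ y\ge 0\Big\}.$$ The rows of $A$ arrive online. Let $d\in\mathbb N$ be an upper bound on the number of non-zeros in any row of $A$, and $\rho$ an upper bound on the ratio of the largest to the smallest positive entry in any column of $A$. **Algorithm (parameter $\delta>0$).** Start with $x=0$, $y=0$, and keep $\mu=\nabla f(\delta x)$ throughout. In round $t$, as long as $\sum_j a_{tj}x_j<1$, increase the time $\tau$ at rate 1, raise each $x_j$ with $a_{tj}>0$ at rate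 $$\frac{\partial x_j}{\partial\tau}=\frac{a_{tj}x_j+\frac1d}{\nabla_j f(x)},$$ and raise $y_t$ at rate $$r=\frac{1}{\ln(1+d\rho)}\min_{\ell}\frac{\nabla_\ell f(\delta x)}{\nabla_\ell f(x)};$$ all other $x_j$ and $y_i$ stay fixed. The trajectory $x$ is continuous during each round, and the rate equations for $x$ hold in the interior of the round's time interval with $\nabla_jf(x)>0$ for all $j$ with $a_{tj}>0$ (so $\nabla_jf(x)=0$ is allowed at the starting moment of a round); $y_t$ is the integral of $r$. Here and below, terms with vanishing denominator are omitted from minima and maxima. For $c>0$ define, in $[-\infty,\infty]$ (with $\infty-\infty=-\infty$), $$\alpha(c)=\frac{\displaystyle\inf_{z\ge0}\min_{\ell}\frac{\nabla_\ell f(z)}{\nabla_\ell f(cz)}}{2\ln(1+\rho d)}-\sup_{z\ge0}\frac{z^{\mathsf T}\nabla f(z)-f(z)}{f(cz)} .$$ **Statement.** 1. For every $\delta>0$, every $A$ as above and every execution of any number of complete rounds, $x$, $y$, $\mu$ are non-decreasing in time, $x\ge0$, each constraint of $(P)$ is satisfied from the end of its round on, and $(y,\mu)$ is feasible for $(D)$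 at all times. 2. If $\nabla_jf(z)>0$ whenever $z\ge0$ and $z_j>0$, then for every $\delta>0$ and every $A$ as above, every execution of the first $k<m$ rounds extends to an execution of the first $k+1$ rounds. 3. For every $c>0$ the algorithm with $\delta=1/c$ has competitive ratio $\alpha(c)$: for every $A$ as above and every execution of all $m$ rounds, the final values satisfy $$\sum_i y_i-f^\star(\mu)\ \ge\ \alpha(c)\, f(x),$$ and, if $\alpha(c)\ge0$, also $\sum_i y_i-f^\star(\mu)\ge \alpha(c)\,\big(\sum_i y'_i-f^\star(\mu')\big)$ for every feasible solution $(y',\mu')$ of $(D)$. Optimizing over $c$: for every $\beta<\sup_{c>0}\alpha(c)$ there is a $\delta>0$, not depending on $m$ or $A$, for which the algorithm is $\beta$-competitive in this sense (and if the supremum is attained at $c$, then $\delta=1/c$ achieves it). -/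

import Mathlib

open Set

/-- The `j`-th coordinate of the gradient of `f` at `z`, for a function `f` considered on the
domain `K` (for `K = univ` this is the usual partial derivative; at boundary points of `K` it is
the derivative relative to `K`). -/
noncomputable def gradCoord {n : ℕ} (K : Set (Fin n → ℝ)) (f : (Fin n → ℝ) → ℝ)
    (j : Fin n) (z : Fin n → ℝ) : ℝ :=
  fderivWithin ℝ f K z (Pi.single j 1)

/-- The Fenchel dual `f⋆(μ) = sup_{z ∈ K} (μᵀ z - f z)` of a function `f` with domain `K`. -/
noncomputable def fenchelDual {n : ℕ} (K : Set (Fin n → ℝ)) (f : (Fin n → ℝ) → ℝ)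
    (μ : Fin n → ℝ) : EReal :=
  ⨆ z ∈ K, ((∑ j, μ j * z j - f z : ℝ) : EReal)

/-- The objective `∑ i, y i - f⋆(μ)` of the packing program. -/
noncomputable def dualObjective {n m : ℕ} (K : Set (Fin n → ℝ)) (f : (Fin n → ℝ) → ℝ)
    (y : Fin m → ℝ) (μ : Fin n → ℝ) : EReal :=
  ((∑ i, y i : ℝ) : EReal) - fenchelDual K f μ

/-- `(y, μ)` is feasible for the packing program: `y ≥ 0` and `Aᵀ y ≤ μ`. -/
def DualFeasible {n m : ℕ} (A : Matrix (Fin m) (Fin n) ℝ) (y : Fin m → ℝ) (μ : Fin n → ℝ) :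
    Prop :=
  (∀ i, 0 ≤ y i) ∧ ∀ j, ∑ i, A i j * y i ≤ μ j

/-- The covering matrices for which `d` and `ρ` are legitimate parameters: the entries are
nonnegative, every single constraint is satisfiable, `d` bounds the row sparsity, and `ρ` bounds
the ratio between the largest and the smallest positive entry of every column. -/
structure IsInstance {n m : ℕ} (A : Matrix (Fin m) (Fin n) ℝ) (d : ℕ) (ρ : ℝ) : Prop where
  nonneg : ∀ i j, 0 ≤ A i j
  satisfiable : ∀ i, ∃ j, 0 < A i j
  sparsity : ∀ i, {j | A i j ≠ 0}.ncard ≤ d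
  col_ratio : ∀ i k j, 0 < A k j → A i j ≤ ρ * A k j

/-- The rate at which the current dual variable is raised at the primal point `x`:
`min_ℓ (∇_ℓ f(δ x) / ∇_ℓ f(x)) / log (1 + d ρ)`, the minimum being over the coordinates whose
denominator does not vanish. -/
noncomputable def dualRate {n : ℕ} (K : Set (Fin n → ℝ)) (f : (Fin n → ℝ) → ℝ)
    (d : ℕ) (ρ δ : ℝ) (x : Fin n → ℝ) : ℝ :=
  (⨅ ℓ : {ℓ : Fin n // 0 < gradCoord K f ℓ x},
      gradCoord K f ℓ (δ • x) / gradCoord K f ℓ x) / Real.log (1 + d * ρ)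

/-- Round `t` of the algorithm, executed during the time interval `[s, e]`. The round lasts
exactly as long as the arriving constraint (row `t` of `A`) is unsatisfied. -/
structure IsRound {n m : ℕ} (K : Set (Fin n → ℝ)) (f : (Fin n → ℝ) → ℝ)
    (A : Matrix (Fin m) (Fin n) ℝ) (d : ℕ) (ρ δ : ℝ) (t : Fin m) (s e : ℝ)
    (x : ℝ → Fin n → ℝ) (y : ℝ → Fin m → ℝ) : Prop where
  le : s ≤ e
  unsatisfied : ∀ τ ∈ Ico s e, ∑ j, A t j * x τ j < 1
  satisfied : 1 ≤ ∑ j, A t j * x e j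
  x_continuous : ContinuousOn x (Icc s e)
  grad_pos : ∀ τ ∈ Ioo s e, ∀ j, 0 < A t j → 0 < gradCoord K f j (x τ)
  x_rate : ∀ τ ∈ Ioo s e, ∀ j, 0 < A t j →
    HasDerivAt (fun σ => x σ j) ((A t j * x τ j + 1 / d) / gradCoord K f j (x τ)) τ
  x_const : ∀ τ ∈ Icc s e, ∀ j, A t j = 0 → x τ j = x s j
  rate_integrable : IntervalIntegrable (fun σ => dualRate K f d ρ δ (x σ)) MeasureTheory.volume s e
  y_rate : ∀ τ ∈ Icc s e, y τ t = y s t + ∫ σ in s..τ, dualRate K f d ρ δ (x σ)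
  y_const : ∀ τ ∈ Icc s e, ∀ i, i ≠ t → y τ i = y s i

/-- The first `k` rounds of the algorithm on the rows of `A`, started from `x = 0`, `y = 0`;
round `t` (counted from `0`) occupies the time interval `[T t, T (t + 1)]`. -/
structure IsRun {n m : ℕ} (K : Set (Fin n → ℝ)) (f : (Fin n → ℝ) → ℝ)
    (A : Matrix (Fin m) (Fin n) ℝ) (d : ℕ) (ρ δ : ℝ) (k : ℕ) (T : ℕ → ℝ)
    (x : ℝ → Fin n → ℝ) (y : ℝ → Fin m → ℝ) : Prop where
  time_zero : T 0 = 0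
  x_zero : x 0 = 0
  y_zero : y 0 = 0
  round : ∀ t : Fin m, (t : ℕ) < k → IsRound K f A d ρ δ t (T t) (T (t + 1)) x y

/-- The dual vector `μ = ∇ f (δ x)` that the algorithm maintains. -/
noncomputable def dualMu {n : ℕ} (K : Set (Fin n → ℝ)) (f : (Fin n → ℝ) → ℝ) (δ : ℝ)
    (x : Fin n → ℝ) : Fin n → ℝ :=
  fun j => gradCoord K f j (δ • x)

/-- The expression
`min_z min_ℓ (∇_ℓ f(z) / ∇_ℓ f(c z)) / (2 ln (1 + ρ d)) - max_z (zᵀ ∇f(z) - f(z)) / f(c z)`,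
with `z` ranging over the nonnegative orthant and vanishing denominators left out. -/
noncomputable def ratioAt {n : ℕ} (K : Set (Fin n → ℝ)) (f : (Fin n → ℝ) → ℝ)
    (d : ℕ) (ρ c : ℝ) : EReal :=
  (⨅ (z : Fin n → ℝ) (_ : 0 ≤ z) (ℓ : Fin n) (_ : 0 < gradCoord K f ℓ (c • z)),
      ((gradCoord K f ℓ z / gradCoord K f ℓ (c • z) : ℝ) : EReal))
    / ((2 * Real.log (1 + ρ * d) : ℝ) : EReal)
  - ⨆ (z : Fin n → ℝ) (_ : 0 ≤ z) (_ : 0 < f (c • z)),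
      (((∑ j, z j * gradCoord K f j z - f z) / f (c • z) : ℝ) : EReal)

/-- The algorithm with parameter `δ` is `β`-competitive: on every instance, each complete run
ends with dual objective at least `β` times the primal objective and, when `β ≥ 0`, at least `β`
times the objective of any feasible solution of the packing program. -/
def IsCompetitive {n : ℕ} (K : Set (Fin n → ℝ)) (f : (Fin n → ℝ) → ℝ)
    (d : ℕ) (ρ δ : ℝ) (β : EReal) : Prop :=
  ∀ (m : ℕ) (A : Matrix (Fin m) (Fin n) ℝ), IsInstance A d ρ →
    ∀ (T : ℕ → ℝ) (x : ℝ → Fin n → ℝ) (y : ℝ → Fin m → ℝ), IsRun K f A d ρ δ m T x y →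
      β * ((f (x (T m)) : ℝ) : EReal)
          ≤ dualObjective K f (y (T m)) (dualMu K f δ (x (T m))) ∧
      (0 ≤ β → ∀ (y' : Fin m → ℝ) (μ' : Fin n → ℝ), DualFeasible A y' μ' →
        β * dualObjective K f y' μ'
          ≤ dualObjective K f (y (T m)) (dualMu K f δ (x (T m))))

section

open Filter Topology

/-! The argument is primal-dual, with time as the common currency. Along a round the chain rule
cancels the partial derivatives, so `f(x)` grows at rate `∑ (a_tj x_j + 1/d)` over the active `j`;
this is at most `1 + 1`, because the row is unsatisfied and has at most `d` non-zeros
(`IsRound.primal_increment_le`). Meanwhile `∑ y` grows at rate at least `inf (∇_ℓ f(z) / ∇_ℓ f(cz))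
/ ln(1 + dρ)`. Since `μ = ∇f(δx)`, Fenchel's equality evaluates `f⋆(μ)` as `zᵀ∇f(z) - f(z)` at `z =
δx`, and `cz = x` for `δ = 1/c`. Subtracting yields `α(c) f(x)` (`ratioAt_mul_le`). Weak duality,
with the final `x` as covering solution, gives the comparison with arbitrary packing solutions.

Packing feasibility: the minimum in the dual rate is at most its `j`-th term, whose denominator also
occurs in the rate of `x_j`. Hence `a_tj dy_t ≤ ∇_j f(δx) / ln(1 + dρ) · d ln(a_tj x_j + 1/d)`. The
gradient factor only increases with time, and replacing `a_tj` by the column maximum `b` only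
enlarges the logarithmic increment, so the rounds telescope to a load of at most `μ_j ln(1 + d b
x_j) / ln(1 + dρ)`. As `x_j` moves only while `a_tj x_j ≤ 1`, also `b x_j ≤ ρ`, and the load is at
most `μ_j` (`IsRun.load_le`).

Existence of executions is an ODE problem without a Lipschitz condition, singular at the start if
`∇_j f` vanishes there. Convexity makes `∇_j f` continuous where `z_j > 0` (`continuousOn_grad`).
Peano's theorem is applied to a field truncated to a box, started `ε` above the given point;
estimates uniform in `ε` allow `ε → 0` (`exists_trajectory`). The round ends when the row is first
satisfied. -/

/-- The standing assumptions on the objective `f` with domain `K`. -/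
structure IsCostFunction {n : ℕ} (K : Set (Fin n → ℝ)) (f : (Fin n → ℝ) → ℝ) : Prop where
  mem : ∀ z : Fin n → ℝ, 0 ≤ z → z ∈ K
  convex : ConvexOn ℝ K f
  nonneg : ∀ z ∈ K, 0 ≤ f z
  mono : MonotoneOn f K
  diff : DifferentiableOn ℝ f K
  grad_mono : ∀ z ∈ K, ∀ z' ∈ K, z' ≤ z → ∀ j, gradCoord K f j z' ≤ gradCoord K f j z
  zero : f 0 = 0

/-! ### Convex analysis of the objective -/

namespace IsCostFunction

variable {n : ℕ} {K : Set (Fin n → ℝ)} {f : (Fin n → ℝ) → ℝ}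

lemma fderivWithin_apply (K : Set (Fin n → ℝ)) (f : (Fin n → ℝ) → ℝ) (z v : Fin n → ℝ) :
    fderivWithin ℝ f K z v = ∑ j, gradCoord K f j z * v j := by
  have := LinearMap.pi_apply_eq_sum_univ (fderivWithin ℝ f K z : (Fin n → ℝ) →ₗ[ℝ] ℝ) v
  simp only [ContinuousLinearMap.coe_coe, smul_eq_mul] at this
  rw [this]
  refine Finset.sum_congr rfl fun j _ => ?_
  rw [mul_comm, gradCoord]
  congr 2
  ext i
  simp [Pi.single_apply, eq_comm]

/-- On the segment from `z` to `w`, the slope of a convex function over `[0, 1]` dominates its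
one-sided derivative at `0`; thus `K` need not be open. -/
lemma gradient_inequality (hf : IsCostFunction K f) {z w : Fin n → ℝ} (hz : z ∈ K) (hw : w ∈ K) :
    ∑ j, gradCoord K f j z * (w j - z j) ≤ f w - f z := by
  have hder : HasFDerivWithinAt f (fderivWithin ℝ f K z) K (AffineMap.lineMap z w (0 : ℝ)) := by
    simpa using (hf.diff z hz).hasFDerivWithinAt
  have hline : HasDerivWithinAt (fun t : ℝ => AffineMap.lineMap z w t) (w - z)
      ((AffineMap.lineMap z w : ℝ →ᵃ[ℝ] (Fin n → ℝ)) ⁻¹' K) 0 :=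
    AffineMap.hasDerivWithinAt_lineMap
  have hcomp := hder.comp_hasDerivWithinAt (0 : ℝ) hline (fun t ht => ht)
  have hcv := hf.convex.comp_affineMap (AffineMap.lineMap z w : ℝ →ᵃ[ℝ] (Fin n → ℝ))
  have := hcv.le_slope_of_hasDerivWithinAt (x := 0) (y := 1) (by simpa using hz)
    (by simpa using hw) one_pos hcomp
  rw [fderivWithin_apply] at this
  simpa [slope_def_field] using this

/-- The range `Ici (-z j)` is what the orthant permits: the derivative is two-sided exactly when `z
j > 0`. -/
lemma hasDerivWithinAt_coord (hf : IsCostFunction K f) {z : Fin n → ℝ} (hz : 0 ≤ z) (j : Fin n) :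
    HasDerivWithinAt (fun t : ℝ => f (z + t • Pi.single j 1)) (gradCoord K f j z)
      (Ici (-z j)) 0 := by
  have hder : HasFDerivWithinAt f (fderivWithin ℝ f K z) K
      (z + (0 : ℝ) • (Pi.single j 1 : Fin n → ℝ)) := by
    simpa using (hf.diff z (hf.mem z hz)).hasFDerivWithinAt
  have hline : HasDerivWithinAt (fun t : ℝ => z + t • (Pi.single j 1 : Fin n → ℝ))
      (Pi.single j 1) (Ici (-z j)) 0 := by
    simpa using (((hasDerivAt_id (0 : ℝ)).smul_const
      (Pi.single j 1 : Fin n → ℝ)).const_add z).hasDerivWithinAt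
  refine hder.comp_hasDerivWithinAt (0 : ℝ) hline fun t ht => hf.mem _ fun i => ?_
  rcases eq_or_ne i j with rfl | h
  · have : -z i ≤ t := ht
    simp; linarith
  · simpa [h] using hz i

lemma grad_nonneg (hf : IsCostFunction K f) {z : Fin n → ℝ} (hz : 0 ≤ z) (j : Fin n) :
    0 ≤ gradCoord K f j z := by
  have hmem : ∀ t : ℝ, 0 ≤ t → z + t • (Pi.single j 1 : Fin n → ℝ) ∈ K := fun t ht =>
    hf.mem _ (add_nonneg hz (smul_nonneg ht (Pi.single_nonneg.2 zero_le_one)))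
  have hd := (hf.hasDerivWithinAt_coord hz j).mono
    (Ici_subset_Ici.2 (neg_nonpos.2 (hz j)))
  have hm : MonotoneOn (fun t : ℝ => f (z + t • Pi.single j 1)) (Ici 0) := by
    intro a ha b hb hab
    refine hf.mono (hmem a ha) (hmem b hb) ?_
    gcongr
    exact Pi.single_nonneg.2 zero_le_one
  rw [← hd.derivWithin (uniqueDiffOn_Ici 0 0 self_mem_Ici)]
  exact hm.derivWithin_nonneg

lemma grad_mono_of_nonneg (hf : IsCostFunction K f) {z w : Fin n → ℝ} (hz : 0 ≤ z) (h : z ≤ w)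
    (j : Fin n) : gradCoord K f j z ≤ gradCoord K f j w :=
  hf.grad_mono w (hf.mem w (hz.trans h)) z (hf.mem z hz) h j

lemma mul_grad_le (hf : IsCostFunction K f) {z : Fin n → ℝ} (hz : 0 ≤ z) (j : Fin n) {t : ℝ}
    (ht : -z j ≤ t) :
    t * gradCoord K f j z ≤ f (z + t • Pi.single j 1) - f z := by
  have hw : (0 : Fin n → ℝ) ≤ z + t • Pi.single j 1 := by
    intro i
    rcases eq_or_ne i j with rfl | h
    · simp; linarith
    · simpa [h] using hz i
  have := hf.gradient_inequality (hf.mem z hz) (hf.mem _ hw)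
  simpa [Pi.single_apply, mul_comm] using this

/-- The partial derivatives are continuous relative to the orthant, away from the face on which
the corresponding coordinate vanishes. -/
lemma continuousOn_grad (hf : IsCostFunction K f) (j : Fin n) :
    ContinuousOn (gradCoord K f j) {z | 0 ≤ z ∧ 0 < z j} := by
  rintro z ⟨hz, hzj⟩
  have hd : HasDerivAt (fun t : ℝ => f (z + t • Pi.single j 1)) (gradCoord K f j z) 0 :=
    (hf.hasDerivWithinAt_coord hz j).hasDerivAt (Ici_mem_nhds (by linarith))
  have hcont : ∀ t : ℝ, -z j < t → Tendsto
      (fun w : Fin n → ℝ => (f (w + t • Pi.single j 1) - f w) / t)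
      (𝓝[{z | 0 ≤ z ∧ 0 < z j}] z) (𝓝 ((f (z + t • Pi.single j 1) - f z) / t)) := by
    intro t ht
    refine Tendsto.div_const (Tendsto.sub ?_ ?_) t
    · have h1 : ContinuousWithinAt f K (z + t • Pi.single j 1) := by
        refine hf.diff.continuousOn _ (hf.mem _ fun i => ?_)
        rcases eq_or_ne i j with rfl | h
        · simp; linarith
        · simpa [h] using hz i
      refine h1.tendsto.comp (tendsto_nhdsWithin_iff.2 ⟨?_, ?_⟩)
      · exact ((continuous_id.add continuous_const).tendsto z).mono_left nhdsWithin_le_nhds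
      · have h2 : ∀ᶠ w in 𝓝[{z : Fin n → ℝ | 0 ≤ z ∧ 0 < z j}] z, -t < w j :=
          nhdsWithin_le_nhds ((continuous_apply j).tendsto z (Ioi_mem_nhds (by linarith)))
        filter_upwards [h2, self_mem_nhdsWithin] with w hw hw'
        refine hf.mem _ fun i => ?_
        rcases eq_or_ne i j with rfl | h
        · simp; linarith
        · simpa [h] using hw'.1 i
    · exact ((hf.diff.continuousOn z (hf.mem z hz)).mono fun w hw => hf.mem w hw.1).tendsto
  have hslope := hasDerivAt_iff_tendsto_slope.1 hd
  have hslope' : ∀ t : ℝ, slope (fun t : ℝ => f (z + t • Pi.single j 1)) 0 t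
      = (f (z + t • Pi.single j 1) - f z) / t := by
    intro t; simp [slope_def_field]
  -- By convexity, difference quotients with `t < 0` bound the partial derivative from below and
  -- those with `t > 0` from above. For fixed `t` they are continuous in the base point, because `f`
  -- is.
  refine tendsto_order.2 ⟨fun b hb => ?_, fun b hb => ?_⟩
  · have h1 : ∀ᶠ t in 𝓝[<] (0 : ℝ), b < (f (z + t • Pi.single j 1) - f z) / t := by
      have := (hslope.mono_left (nhdsWithin_mono 0 (s := Iio 0) fun t ht => ne_of_lt ht)).eventually
        (lt_mem_nhds hb)
      simpa only [hslope'] using this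
    have h2 : ∀ᶠ t in 𝓝[<] (0 : ℝ), -z j < t :=
      nhdsWithin_le_nhds (Ioi_mem_nhds (by linarith))
    obtain ⟨t, ht1, ht2, ht0 : t < 0⟩ := (h1.and (h2.and self_mem_nhdsWithin)).exists
    have h3 : ∀ᶠ w in 𝓝[{z : Fin n → ℝ | 0 ≤ z ∧ 0 < z j}] z, -t < w j :=
      nhdsWithin_le_nhds ((continuous_apply j).tendsto z (Ioi_mem_nhds (by linarith)))
    filter_upwards [(hcont t ht2).eventually (lt_mem_nhds ht1), h3, self_mem_nhdsWithin]
      with w hw hwt hw'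
    refine hw.trans_le ?_
    rw [div_le_iff_of_neg ht0, mul_comm]
    exact hf.mul_grad_le hw'.1 j (by linarith)
  · have h1 : ∀ᶠ t in 𝓝[>] (0 : ℝ), (f (z + t • Pi.single j 1) - f z) / t < b := by
      have := (hslope.mono_left (nhdsWithin_mono 0 (s := Ioi 0) fun t ht => ne_of_gt ht)).eventually
        (gt_mem_nhds hb)
      simpa only [hslope'] using this
    obtain ⟨t, ht1, ht0 : 0 < t⟩ := (h1.and self_mem_nhdsWithin).exists
    filter_upwards [(hcont t (by linarith)).eventually (gt_mem_nhds ht1), self_mem_nhdsWithin]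
      with w hw hw'
    refine lt_of_le_of_lt ?_ hw
    rw [le_div_iff₀ ht0, mul_comm]
    exact hf.mul_grad_le hw'.1 j (by linarith [hw'.2])

/-- Fenchel's equality at a gradient. -/
lemma fenchelDual_grad (hf : IsCostFunction K f) {z : Fin n → ℝ} (hz : z ∈ K) :
    fenchelDual K f (fun j => gradCoord K f j z)
      = ((∑ j, z j * gradCoord K f j z - f z : ℝ) : EReal) := by
  refine le_antisymm (iSup₂_le fun w hw => EReal.coe_le_coe_iff.2 ?_) ?_
  · have := hf.gradient_inequality hz hw
    simp only [mul_sub, Finset.sum_sub_distrib] at this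
    simp only [mul_comm (z _)]
    linarith
  · simp only [mul_comm (z _)]
    exact le_iSup₂ (f := fun (w : Fin n → ℝ) (_ : w ∈ K) =>
      ((∑ j, gradCoord K f j z * w j - f w : ℝ) : EReal)) z hz

end IsCostFunction

/-- Weak duality between the covering and the packing program. -/
lemma dualObjective_le {n m : ℕ} {K : Set (Fin n → ℝ)} {f : (Fin n → ℝ) → ℝ}
    {A : Matrix (Fin m) (Fin n) ℝ} {x : Fin n → ℝ} (hxK : x ∈ K) (hx : 0 ≤ x)
    (hcov : ∀ i, 1 ≤ ∑ j, A i j * x j) {y : Fin m → ℝ} {μ : Fin n → ℝ}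
    (h : DualFeasible A y μ) : dualObjective K f y μ ≤ (f x : EReal) := by
  have h1 : ∑ i, y i ≤ ∑ j, μ j * x j :=
    calc ∑ i, y i ≤ ∑ i, y i * ∑ j, A i j * x j :=
          Finset.sum_le_sum fun i _ => le_mul_of_one_le_right (h.1 i) (hcov i)
      _ = ∑ j, (∑ i, A i j * y i) * x j := by
          simp only [Finset.mul_sum, Finset.sum_mul]
          rw [Finset.sum_comm]
          refine Finset.sum_congr rfl fun j _ => Finset.sum_congr rfl fun i _ => by ring
      _ ≤ ∑ j, μ j * x j :=
          Finset.sum_le_sum fun j _ => mul_le_mul_of_nonneg_right (h.2 j) (hx j)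
  have h2 : ((∑ j, μ j * x j - f x : ℝ) : EReal) ≤ fenchelDual K f μ :=
    le_iSup₂ (f := fun (w : Fin n → ℝ) (_ : w ∈ K) =>
      ((∑ j, μ j * w j - f w : ℝ) : EReal)) x hxK
  calc dualObjective K f y μ
      ≤ ((∑ j, μ j * x j : ℝ) : EReal) - ((∑ j, μ j * x j - f x : ℝ) : EReal) :=
        EReal.sub_le_sub (EReal.coe_le_coe_iff.2 h1) h2
    _ = (f x : EReal) := by rw [← EReal.coe_sub]; congr 1; ring

/-! ### Monotonicity in time from the sign of the derivative -/

lemma monotoneOn_Icc_of_hasDerivAt_nonneg {u u' : ℝ → ℝ} {s e : ℝ} (hc : ContinuousOn u (Icc s e))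
    (hd : ∀ τ ∈ Ioo s e, HasDerivAt u (u' τ) τ) (hn : ∀ τ ∈ Ioo s e, 0 ≤ u' τ) :
    MonotoneOn u (Icc s e) := by
  refine monotoneOn_of_deriv_nonneg (convex_Icc s e) hc ?_ ?_
  · rw [interior_Icc]
    exact fun τ hτ => (hd τ hτ).differentiableAt.differentiableWithinAt
  · rw [interior_Icc]
    exact fun τ hτ => by rw [(hd τ hτ).deriv]; exact hn τ hτ

/-- A function that increases wherever it exceeds a level `lo`, and starts above that level, is
monotone. -/
lemma monotoneOn_Icc_of_hasDerivAt_pos_of_lt {u u' : ℝ → ℝ} {s e lo : ℝ}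
    (hc : ContinuousOn u (Icc s e)) (hd : ∀ τ ∈ Ioo s e, HasDerivAt u (u' τ) τ)
    (hpos : ∀ τ ∈ Ioo s e, lo < u τ → 0 < u' τ) (hlo : lo < u s) : MonotoneOn u (Icc s e) := by
  have key : ∀ τ ∈ Ioo s e, lo < u τ := by
    intro τ hτ
    obtain ⟨c, hc1, hc2⟩ := exists_between hlo
    refine hc1.trans_le ?_
    -- No derivative is available at `s`, so the barrier argument starts at a slightly later `σ`,
    -- where `u` still exceeds `c` by continuity. At level `c > lo` the derivative is positive, so
    -- `u` cannot cross it downwards.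
    have hev : ∀ᶠ σ in 𝓝[>] s, c < u σ := by
      have h1 : Tendsto u (𝓝[Icc s e] s) (𝓝 (u s)) :=
        hc s (left_mem_Icc.2 (hτ.1.trans hτ.2).le)
      have h2 : 𝓝[>] s ≤ 𝓝[Icc s e] s := by
        rw [← nhdsWithin_Ioo_eq_nhdsGT (hτ.1.trans hτ.2)]
        exact nhdsWithin_mono _ Ioo_subset_Icc_self
      exact (h1.mono_left h2).eventually (lt_mem_nhds hc2)
    obtain ⟨σ, hσ, hσ1⟩ := (hev.and (Ioo_mem_nhdsGT hτ.1)).exists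
    have := image_le_of_deriv_right_lt_deriv_boundary' (f := fun τ => -u τ) (f' := fun τ => -u' τ)
      (a := σ) (b := τ) (B := fun _ => -c) (B' := fun _ => 0)
      (hc.neg.mono (Icc_subset_Icc hσ1.1.le hτ.2.le))
      (fun r hr => (hd r ⟨hσ1.1.trans_le hr.1, hr.2.trans hτ.2⟩).neg.hasDerivWithinAt)
      (neg_le_neg hσ.le) continuousOn_const (fun r _ => hasDerivWithinAt_const _ _ _)
      (fun r hr hrc => neg_lt_zero.2 (hpos r ⟨hσ1.1.trans_le hr.1, hr.2.trans hτ.2⟩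
        (by rw [neg_inj] at hrc; rwa [hrc])))
      (right_mem_Icc.2 hσ1.2.le)
    exact neg_le_neg_iff.1 this
  exact monotoneOn_Icc_of_hasDerivAt_nonneg hc hd fun τ hτ => (hpos τ hτ (key τ hτ)).le

/-! ### Instance parameters and the dual rate -/

namespace IsInstance

variable {n m : ℕ} {A : Matrix (Fin m) (Fin n) ℝ} {d : ℕ} {ρ : ℝ}

lemma one_le_d (hA : IsInstance A d ρ) (i : Fin m) : 1 ≤ d := by
  obtain ⟨j, hj⟩ := hA.satisfiable i
  refine le_trans ?_ (hA.sparsity i)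
  exact Nat.one_le_iff_ne_zero.2 (Set.ncard_ne_zero_of_mem (a := j) hj.ne')

lemma one_le_rho (hA : IsInstance A d ρ) (i : Fin m) : 1 ≤ ρ := by
  obtain ⟨j, hj⟩ := hA.satisfiable i
  exact (le_mul_iff_one_le_left hj).1 (hA.col_ratio i i j hj)

lemma log_pos (hA : IsInstance A d ρ) (i : Fin m) : 0 < Real.log (1 + d * ρ) := by
  have h1 : (1 : ℝ) ≤ d := by exact_mod_cast hA.one_le_d i
  have h2 := hA.one_le_rho i
  exact Real.log_pos (by nlinarith)

end IsInstance

section Rate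

variable {n : ℕ} {K : Set (Fin n → ℝ)} {f : (Fin n → ℝ) → ℝ} {d : ℕ} {ρ δ : ℝ}

lemma dualRate_nonneg (hf : IsCostFunction K f) (hδ : 0 < δ) (hL : 0 < Real.log (1 + d * ρ))
    {z : Fin n → ℝ} (hz : 0 ≤ z) : 0 ≤ dualRate K f d ρ δ z :=
  div_nonneg (Real.iInf_nonneg fun ℓ =>
    div_nonneg (hf.grad_nonneg (smul_nonneg hδ.le hz) ℓ) ℓ.2.le) hL.le

lemma dualRate_le (hL : 0 < Real.log (1 + d * ρ)) {z : Fin n → ℝ} {j : Fin n}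
    (hj : 0 < gradCoord K f j z) :
    dualRate K f d ρ δ z
      ≤ gradCoord K f j (δ • z) / Real.log (1 + d * ρ) * (gradCoord K f j z)⁻¹ := by
  rw [dualRate, div_mul_eq_mul_div, ← div_eq_mul_inv]
  exact div_le_div_of_nonneg_right (ciInf_le (Set.finite_range _).bddBelow
    (⟨j, hj⟩ : {ℓ : Fin n // 0 < gradCoord K f ℓ z})) hL.le

lemma le_dualRate (hL : 0 < Real.log (1 + d * ρ)) {z : Fin n → ℝ} {j : Fin n}
    (hj : 0 < gradCoord K f j z) {r : ℝ}
    (hr : ∀ ℓ, 0 < gradCoord K f ℓ z → r ≤ gradCoord K f ℓ (δ • z) / gradCoord K f ℓ z) :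
    r / Real.log (1 + d * ρ) ≤ dualRate K f d ρ δ z := by
  -- A real infimum over an empty type is `0`, so the lower bound needs a coordinate with positive
  -- partial derivative.
  have : Nonempty {ℓ : Fin n // 0 < gradCoord K f ℓ z} := ⟨⟨j, hj⟩⟩
  exact div_le_div_of_nonneg_right (le_ciInf fun ℓ => hr ℓ ℓ.2) hL.le

end Rate

/-! ### Analysis of a single round -/

namespace IsRound

variable {n m : ℕ} {K : Set (Fin n → ℝ)} {f : (Fin n → ℝ) → ℝ} {A : Matrix (Fin m) (Fin n) ℝ}
  {d : ℕ} {ρ δ : ℝ} {t : Fin m} {s e : ℝ} {x : ℝ → Fin n → ℝ} {y : ℝ → Fin m → ℝ}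

/-- A round constrains the trajectories only on `[s, e]`, with derivatives taken in the open
interval; this permits gluing rounds. -/
lemma congr {x' : ℝ → Fin n → ℝ} {y' : ℝ → Fin m → ℝ} (h : IsRound K f A d ρ δ t s e x y)
    (hx : ∀ τ ∈ Icc s e, x' τ = x τ) (hy : ∀ τ ∈ Icc s e, y' τ = y τ) :
    IsRound K f A d ρ δ t s e x' y' := by
  have hs : s ∈ Icc s e := left_mem_Icc.2 h.le
  have he : e ∈ Icc s e := right_mem_Icc.2 h.le
  have hev : ∀ τ ∈ Ioo s e, x' =ᶠ[𝓝 τ] x := fun τ hτ => by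
    filter_upwards [Icc_mem_nhds hτ.1 hτ.2] with σ hσ using hx σ hσ
  have hint : ∀ τ ∈ Icc s e, ∫ σ in s..τ, dualRate K f d ρ δ (x' σ)
      = ∫ σ in s..τ, dualRate K f d ρ δ (x σ) := fun τ hτ => by
    refine intervalIntegral.integral_congr fun σ hσ => ?_
    rw [uIcc_of_le hτ.1] at hσ
    simp only [hx σ ⟨hσ.1, hσ.2.trans hτ.2⟩]
  refine ⟨h.le, fun τ hτ => ?_, ?_, h.x_continuous.congr hx, fun τ hτ j hj => ?_,
    fun τ hτ j hj => ?_, fun τ hτ j hj => ?_, ?_, fun τ hτ => ?_, fun τ hτ i hi => ?_⟩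
  · rw [hx τ (Ico_subset_Icc_self hτ)]; exact h.unsatisfied τ hτ
  · rw [hx e he]; exact h.satisfied
  · rw [hx τ (Ioo_subset_Icc_self hτ)]; exact h.grad_pos τ hτ j hj
  · rw [hx τ (Ioo_subset_Icc_self hτ)]
    exact (h.x_rate τ hτ j hj).congr_of_eventuallyEq ((hev τ hτ).fun_comp fun z => z j)
  · rw [hx τ hτ, hx s hs]; exact h.x_const τ hτ j hj
  · refine h.rate_integrable.congr fun σ hσ => ?_
    rw [uIoc_of_le h.le] at hσ
    simp only [hx σ (Ioc_subset_Icc_self hσ)]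
  · rw [hy τ hτ, hy s hs, hint τ hτ]; exact h.y_rate τ hτ
  · rw [hy τ hτ, hy s hs]; exact h.y_const τ hτ i hi

lemma coord_continuous (h : IsRound K f A d ρ δ t s e x y) (j : Fin n) :
    ContinuousOn (fun σ => x σ j) (Icc s e) :=
  (continuous_apply j).comp_continuousOn h.x_continuous

/-- The sign of the rate of `x_j` depends on `x_j` itself: it is positive only above the level
`-(1/d) / A t j`. Starting from `x s ≥ 0` the coordinate never gets back to that level. -/
lemma x_mono (h : IsRound K f A d ρ δ t s e x y) (hA : IsInstance A d ρ) (hx : 0 ≤ x s) :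
    MonotoneOn x (Icc s e) := by
  have hd : (0 : ℝ) < 1 / d := one_div_pos.2 (by exact_mod_cast hA.one_le_d t)
  have key : ∀ j, MonotoneOn (fun σ => x σ j) (Icc s e) := by
    intro j
    rcases (hA.nonneg t j).eq_or_lt' with h0 | hj
    · intro a ha b hb _
      simp only [h.x_const a ha j h0, h.x_const b hb j h0, le_refl]
    · refine monotoneOn_Icc_of_hasDerivAt_pos_of_lt (lo := -(1 / d) / A t j)
        (h.coord_continuous j) (fun τ hτ => h.x_rate τ hτ j hj)
        (fun τ hτ hlo => div_pos ?_ (h.grad_pos τ hτ j hj)) ?_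
      · rw [div_lt_iff₀ hj] at hlo
        linarith
      · exact (div_neg_of_neg_of_pos (neg_neg_of_pos hd) hj).trans_le (hx j)
  exact fun a ha b hb hab j => key j ha hb hab

lemma x_nonneg (h : IsRound K f A d ρ δ t s e x y) (hA : IsInstance A d ρ) (hx : 0 ≤ x s)
    {τ : ℝ} (hτ : τ ∈ Icc s e) : 0 ≤ x τ :=
  hx.trans (h.x_mono hA hx (left_mem_Icc.2 h.le) hτ hτ.1)

lemma y_mono (h : IsRound K f A d ρ δ t s e x y) (hf : IsCostFunction K f) (hA : IsInstance A d ρ)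
    (hδ : 0 < δ) (hx : 0 ≤ x s) : MonotoneOn y (Icc s e) := by
  intro a ha b hb hab i
  by_cases hi : i = t
  · subst hi
    rw [h.y_rate a ha, h.y_rate b hb]
    refine add_le_add_right ?_ _
    have hsub : IntervalIntegrable (fun σ => dualRate K f d ρ δ (x σ)) MeasureTheory.volume s b :=
      h.rate_integrable.mono_set (by
        rw [uIcc_of_le hb.1, uIcc_of_le h.le]; exact Icc_subset_Icc_right hb.2)
    refine intervalIntegral.integral_mono_interval le_rfl ha.1 hab ?_ hsub
    refine (MeasureTheory.ae_restrict_iff' measurableSet_Ioc).2 (.of_forall fun σ hσ => ?_)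
    exact dualRate_nonneg hf hδ (hA.log_pos i) (h.x_nonneg hA hx ⟨hσ.1.le, hσ.2.trans hb.2⟩)
  · rw [h.y_const a ha i hi, h.y_const b hb i hi]

lemma active_le_one (h : IsRound K f A d ρ δ t s e x y) (hA : IsInstance A d ρ) (hx : 0 ≤ x s)
    {τ : ℝ} (hτ : τ ∈ Ico s e) (j : Fin n) : A t j * x τ j ≤ 1 :=
  (Finset.single_le_sum (f := fun j => A t j * x τ j) (fun i _ => mul_nonneg (hA.nonneg t i)
    (h.x_nonneg hA hx (Ico_subset_Icc_self hτ) i)) (Finset.mem_univ j)).trans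
    (h.unsatisfied τ hτ).le

/-- In a round of positive length every active coordinate stays in the box `A t j * x j ≤ 1`. -/
lemma active_le_one_of_lt (h : IsRound K f A d ρ δ t s e x y) (hA : IsInstance A d ρ)
    (hx : 0 ≤ x s) (hse : s < e) {τ : ℝ} (hτ : τ ∈ Icc s e) (j : Fin n) : A t j * x τ j ≤ 1 := by
  have hc : ContinuousOn (fun σ => A t j * x σ j) (Icc s e) :=
    continuousOn_const.mul (h.coord_continuous j)
  -- The bound at `e` follows by continuity from `[s, e)`, whose closure contains `e` only if `s <
  -- e`. A round of length zero may start with an oversatisfied row.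
  exact ContinuousWithinAt.closure_le (by rwa [closure_Ico hse.ne])
    ((hc τ hτ).mono Ico_subset_Icc_self) continuousWithinAt_const
    fun σ hσ => h.active_le_one hA hx hσ j

/-- The increment of the current dual variable is controlled by the logarithmic increment of each
active primal variable. -/
lemma mul_y_increment_le (h : IsRound K f A d ρ δ t s e x y) (hf : IsCostFunction K f)
    (hA : IsInstance A d ρ) (hδ : 0 < δ) (hx : 0 ≤ x s) {j : Fin n} (hj : 0 < A t j)
    {τ : ℝ} (hτ : τ ∈ Icc s e) :
    A t j * (y τ t - y s t) ≤ gradCoord K f j (δ • x τ) / Real.log (1 + d * ρ) *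
      (Real.log (A t j * x τ j + 1 / d) - Real.log (A t j * x s j + 1 / d)) := by
  have hd : (0 : ℝ) < 1 / d := one_div_pos.2 (by exact_mod_cast hA.one_le_d t)
  have hL := hA.log_pos t
  have hpos : ∀ σ ∈ Icc s e, 0 < A t j * x σ j + 1 / d := fun σ hσ =>
    add_pos_of_nonneg_of_pos (mul_nonneg hj.le (h.x_nonneg hA hx hσ j)) hd
  have hsub : Icc s τ ⊆ Icc s e := Icc_subset_Icc_right hτ.2
  have hsub' : Ioo s τ ⊆ Ioo s e := Ioo_subset_Ioo_right hτ.2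
  have hcont : ContinuousOn (fun σ => Real.log (A t j * x σ j + 1 / d)) (Icc s τ) :=
    ((continuousOn_const.mul ((h.coord_continuous j).mono hsub)).add continuousOn_const).log
      fun σ hσ => (hpos σ (hsub hσ)).ne'
  have hderiv : ∀ σ ∈ Ioo s τ, HasDerivAt (fun σ => Real.log (A t j * x σ j + 1 / d))
      (A t j * (gradCoord K f j (x σ))⁻¹) σ := by
    intro σ hσ
    have hσ' := hsub' hσ
    have hp := hpos σ (Ioo_subset_Icc_self hσ')
    refine ((((h.x_rate σ hσ' j hj).const_mul (A t j)).add_const (1 / (d : ℝ))).log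
      hp.ne').congr_deriv ?_
    have := h.grad_pos σ hσ' j hj
    field_simp
  have hnn : ∀ σ ∈ Ioo s τ, 0 ≤ A t j * (gradCoord K f j (x σ))⁻¹ := fun σ hσ =>
    mul_nonneg hj.le (inv_nonneg.2 (h.grad_pos σ (hsub' hσ) j hj).le)
  -- The inverse derivative may blow up at `s`; it is integrable because, up to the factor `A t j`,
  -- it is the nonnegative derivative of a function continuous up to the endpoints.
  have hint : IntervalIntegrable (fun σ => A t j * (gradCoord K f j (x σ))⁻¹)
      MeasureTheory.volume s τ := by
    refine intervalIntegral.intervalIntegrable_deriv_of_nonneg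
      (g := fun σ => Real.log (A t j * x σ j + 1 / d)) ?_ ?_ ?_
    · rwa [uIcc_of_le hτ.1]
    · rwa [min_eq_left hτ.1, max_eq_right hτ.1]
    · rwa [min_eq_left hτ.1, max_eq_right hτ.1]
  rw [← intervalIntegral.integral_eq_sub_of_hasDerivAt_of_le hτ.1 hcont hderiv hint, h.y_rate τ hτ,
    add_sub_cancel_left, ← intervalIntegral.integral_const_mul, ← intervalIntegral.integral_const_mul]
  refine intervalIntegral.integral_mono_on_of_le_Ioo hτ.1 (IntervalIntegrable.const_mul
    (h.rate_integrable.mono_set (by rwa [uIcc_of_le hτ.1, uIcc_of_le h.le])) _)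
    (hint.const_mul _) fun σ hσ => ?_
  have hσ' := Ioo_subset_Icc_self (hsub' hσ)
  have hg := h.grad_pos σ (hsub' hσ) j hj
  calc A t j * dualRate K f d ρ δ (x σ)
      ≤ A t j * (gradCoord K f j (δ • x σ) / Real.log (1 + d * ρ) * (gradCoord K f j (x σ))⁻¹) :=
        mul_le_mul_of_nonneg_left (dualRate_le hL hg) hj.le
    -- The factor `∇_j f(δ x)` is frozen at its largest value, the one at the final time `τ`.
    _ ≤ A t j * (gradCoord K f j (δ • x τ) / Real.log (1 + d * ρ) * (gradCoord K f j (x σ))⁻¹) := by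
        have : gradCoord K f j (δ • x σ) ≤ gradCoord K f j (δ • x τ) :=
          hf.grad_mono_of_nonneg (smul_nonneg hδ.le (h.x_nonneg hA hx hσ'))
            (smul_le_smul_of_nonneg_left (h.x_mono hA hx hσ' hτ hσ.2.le) hδ.le) j
        have := inv_pos.2 hg
        gcongr
    _ = _ := by ring

/-- Along a round the primal objective grows at rate at most `2`. -/
lemma primal_increment_le (h : IsRound K f A d ρ δ t s e x y) (hf : IsCostFunction K f)
    (hA : IsInstance A d ρ) (hx : 0 ≤ x s) : f (x e) - f (x s) ≤ 2 * (e - s) := by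
  classical
  have hd : (0 : ℝ) < d := by exact_mod_cast hA.one_le_d t
  have hmaps : MapsTo x (Icc s e) K := fun τ hτ => hf.mem _ (h.x_nonneg hA hx hτ)
  have hder : ∀ τ ∈ Ioo s e, HasDerivAt (fun σ => f (x σ))
      (∑ j, gradCoord K f j (x τ) * if 0 < A t j then
        (A t j * x τ j + 1 / d) / gradCoord K f j (x τ) else 0) τ := by
    intro τ hτ
    have hxd : HasDerivAt x (fun j => if 0 < A t j then
        (A t j * x τ j + 1 / d) / gradCoord K f j (x τ) else 0) τ := by
      refine hasDerivAt_pi.2 fun j => ?_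
      split_ifs with hj
      · exact h.x_rate τ hτ j hj
      · refine (hasDerivAt_const τ (x s j)).congr_of_eventuallyEq ?_
        filter_upwards [Icc_mem_nhds hτ.1 hτ.2] with σ hσ
        exact h.x_const σ hσ j (le_antisymm (not_lt.1 hj) (hA.nonneg t j))
    have := ((hf.diff _ (hmaps (Ioo_subset_Icc_self hτ))).hasFDerivWithinAt).comp_hasDerivWithinAt
      τ hxd.hasDerivWithinAt hmaps
    rw [IsCostFunction.fderivWithin_apply] at this
    exact this.hasDerivAt (Icc_mem_nhds hτ.1 hτ.2)
  refine (convex_Icc s e).image_sub_le_mul_sub_of_deriv_le (f := fun σ => f (x σ)) (C := 2)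
    (hf.diff.continuousOn.comp h.x_continuous hmaps) ?_ ?_ s (left_mem_Icc.2 h.le) e
    (right_mem_Icc.2 h.le) h.le
  · rw [interior_Icc]
    exact fun τ hτ => (hder τ hτ).differentiableAt.differentiableWithinAt
  · rw [interior_Icc]
    intro τ hτ
    rw [(hder τ hτ).deriv]
    have hxτ := h.x_nonneg hA hx (Ioo_subset_Icc_self hτ)
    -- The gradients cancel. The sum of `A t j * x j` is below `1` while the row is unsatisfied, and
    -- the summand `1/d` occurs at most `d` times.
    calc ∑ j, gradCoord K f j (x τ) * (if 0 < A t j then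
          (A t j * x τ j + 1 / d) / gradCoord K f j (x τ) else 0)
        = ∑ j, if A t j ≠ 0 then A t j * x τ j + 1 / d else 0 := by
          refine Finset.sum_congr rfl fun j _ => ?_
          rcases (hA.nonneg t j).eq_or_lt' with h0 | hj
          · simp [h0]
          · simp only [hj, if_true, hj.ne', ne_eq, not_false_eq_true]
            exact mul_div_cancel₀ _ (h.grad_pos τ hτ j hj).ne'
      _ = ∑ j, A t j * x τ j + ∑ j, if A t j ≠ 0 then (1 / d : ℝ) else 0 := by
          rw [← Finset.sum_add_distrib]
          refine Finset.sum_congr rfl fun j _ => ?_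
          split_ifs with h0
          · rfl
          · simp [not_not.1 h0]
      _ ≤ 1 + 1 := by
          refine add_le_add (h.unsatisfied τ (Ioo_subset_Ico_self hτ)).le ?_
          rw [← Finset.sum_filter, Finset.sum_const, nsmul_eq_mul, mul_one_div, div_le_one hd]
          have := hA.sparsity t
          rw [Set.ncard_eq_toFinset_card', Set.toFinset_ofPred] at this
          exact_mod_cast this
      _ = 2 := by norm_num

lemma le_y_increment (h : IsRound K f A d ρ δ t s e x y) (hA : IsInstance A d ρ) (hx : 0 ≤ x s)
    {r : ℝ} (hr : ∀ z : Fin n → ℝ, 0 ≤ z → ∀ ℓ, 0 < gradCoord K f ℓ z →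
      r ≤ gradCoord K f ℓ (δ • z) / gradCoord K f ℓ z) :
    r / Real.log (1 + d * ρ) * (e - s) ≤ y e t - y s t := by
  rw [h.y_rate e (right_mem_Icc.2 h.le), add_sub_cancel_left]
  have : r / Real.log (1 + d * ρ) * (e - s) = ∫ _ in s..e, r / Real.log (1 + d * ρ) := by
    rw [intervalIntegral.integral_const, smul_eq_mul, mul_comm]
  rw [this]
  obtain ⟨j, hj⟩ := hA.satisfiable t
  refine intervalIntegral.integral_mono_on_of_le_Ioo h.le intervalIntegrable_const
    h.rate_integrable fun σ hσ => ?_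
  exact le_dualRate (hA.log_pos t) (h.grad_pos σ hσ j hj)
    fun ℓ hℓ => hr _ (h.x_nonneg hA hx (Ioo_subset_Icc_self hσ)) ℓ hℓ

end IsRound

namespace IsRound

variable {n m : ℕ} {K : Set (Fin n → ℝ)} {f : (Fin n → ℝ) → ℝ} {A : Matrix (Fin m) (Fin n) ℝ}
  {d : ℕ} {ρ δ : ℝ} {t : Fin m} {s e : ℝ} {x : ℝ → Fin n → ℝ} {y : ℝ → Fin m → ℝ}

/-- A moving `x_j` satisfies `A t j * x_j ≤ 1` with `b ≤ ρ * A t j`; otherwise `x_j` is unchanged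
and the old bound persists. In the application `b` is the largest entry of column `j`. -/
lemma scaled_le (h : IsRound K f A d ρ δ t s e x y) (hA : IsInstance A d ρ) (hx : 0 ≤ x s)
    {j : Fin n} {b : ℝ} (hb : ∀ k, 0 < A k j → b ≤ ρ * A k j) (hs : b * x s j ≤ ρ)
    {τ : ℝ} (hτ : τ ∈ Icc s e) : b * x τ j ≤ ρ := by
  rcases (hA.nonneg t j).eq_or_lt' with h0 | hj
  · rwa [h.x_const τ hτ j h0]
  · rcases h.le.eq_or_lt with rfl | hse
    · rwa [le_antisymm hτ.2 hτ.1]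
    · calc b * x τ j ≤ ρ * A t j * x τ j :=
            mul_le_mul_of_nonneg_right (hb t hj) (h.x_nonneg hA hx hτ j)
        _ = ρ * (A t j * x τ j) := by ring
        _ ≤ ρ * 1 := mul_le_mul_of_nonneg_left (h.active_le_one_of_lt hA hx hse hτ j)
            (zero_le_one.trans (hA.one_le_rho t))
        _ = ρ := mul_one ρ

/-- A round preserves the logarithmic bound on the load of every packing constraint. -/
lemma load_le (h : IsRound K f A d ρ δ t s e x y) (hf : IsCostFunction K f)
    (hA : IsInstance A d ρ) (hδ : 0 < δ) (hx : 0 ≤ x s) {j : Fin n} {b : ℝ}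
    (hb : ∀ k, A k j ≤ b)
    (hs : ∑ i, A i j * y s i
      ≤ gradCoord K f j (δ • x s) / Real.log (1 + d * ρ) * Real.log (1 + d * b * x s j))
    {τ : ℝ} (hτ : τ ∈ Icc s e) :
    ∑ i, A i j * y τ i
      ≤ gradCoord K f j (δ • x τ) / Real.log (1 + d * ρ) * Real.log (1 + d * b * x τ j) := by
  have hd : (0 : ℝ) < d := by exact_mod_cast hA.one_le_d t
  have hL := hA.log_pos t
  have hb0 : 0 ≤ b := (hA.nonneg t j).trans (hb t)
  have hxτ := h.x_nonneg hA hx hτ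
  have hxx : x s ≤ x τ := h.x_mono hA hx (left_mem_Icc.2 h.le) hτ hτ.1
  have hsum : ∑ i, A i j * y τ i = ∑ i, A i j * y s i + A t j * (y τ t - y s t) := by
    have : ∑ i, (A i j * y τ i - A i j * y s i) = A t j * y τ t - A t j * y s t :=
      Finset.sum_eq_single t (fun i _ hi => by rw [h.y_const τ hτ i hi, sub_self])
        fun h => absurd (Finset.mem_univ t) h
    rw [Finset.sum_sub_distrib] at this
    linarith
  have hg : gradCoord K f j (δ • x s) ≤ gradCoord K f j (δ • x τ) :=
    hf.grad_mono_of_nonneg (smul_nonneg hδ.le hx) (smul_le_smul_of_nonneg_left hxx hδ.le) j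
  have hbx : ∀ z : ℝ, 0 ≤ z → 0 < 1 + d * b * z := fun z hz => by positivity
  have hlog0 : 0 ≤ Real.log (1 + d * b * x s j) := Real.log_nonneg (by
    have := mul_nonneg (mul_nonneg hd.le hb0) (hx j)
    linarith)
  have h1 : ∑ i, A i j * y s i
      ≤ gradCoord K f j (δ • x τ) / Real.log (1 + d * ρ) * Real.log (1 + d * b * x s j) :=
    hs.trans (by gcongr)
  have h2 : A t j * (y τ t - y s t) ≤ gradCoord K f j (δ • x τ) / Real.log (1 + d * ρ) *
      (Real.log (1 + d * b * x τ j) - Real.log (1 + d * b * x s j)) := by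
    have hg0 : 0 ≤ gradCoord K f j (δ • x τ) / Real.log (1 + d * ρ) :=
      div_nonneg (hf.grad_nonneg (smul_nonneg hδ.le hxτ) j) hL.le
    rcases (hA.nonneg t j).eq_or_lt' with h0 | hj
    · rw [h0, h.x_const τ hτ j h0]; simp
    · refine (h.mul_y_increment_le hf hA hδ hx hj hτ).trans (mul_le_mul_of_nonneg_left ?_ hg0)
      have hp : ∀ z : ℝ, 0 ≤ z → 0 < A t j * z + 1 / d := fun z hz => by positivity
      have e1 := hp _ (hx j)
      have e2 := hp _ (hxτ j)
      have e3 := hbx _ (hx j)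
      have e4 := hbx _ (hxτ j)
      -- Passing from `A t j` to `b` enlarges the logarithmic increment: after cross-multiplication
      -- the difference of the two sides is `(b - A t j) * (x τ j - x s j) ≥ 0`. With one `b` for
      -- all rounds the increments telescope.
      rw [sub_le_iff_le_add, sub_add_eq_add_sub, le_sub_iff_add_le,
        ← Real.log_mul e2.ne' e3.ne', ← Real.log_mul e4.ne' e1.ne']
      refine Real.log_le_log (mul_pos e2 e3) ?_
      have e5 : (d : ℝ) * (1 / d) = 1 := mul_one_div_cancel hd.ne'
      have e6 : 0 ≤ (b - A t j) * (x τ j - x s j) :=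
        mul_nonneg (sub_nonneg.2 (hb t)) (sub_nonneg.2 (hxx j))
      have e7 : (1 + d * b * x τ j) * (A t j * x s j + 1 / d)
          - (A t j * x τ j + 1 / d) * (1 + d * b * x s j)
          = (b - A t j) * (x τ j - x s j) + (d * (1 / d) - 1) * (b * (x τ j - x s j)) := by ring
      rw [e5, sub_self, zero_mul, add_zero] at e7
      linarith
  rw [hsum]
  calc _ ≤ _ := add_le_add h1 h2
    _ = _ := by ring

end IsRound

/-! ### Induction over the rounds -/

namespace IsRun

variable {n m : ℕ} {K : Set (Fin n → ℝ)} {f : (Fin n → ℝ) → ℝ} {A : Matrix (Fin m) (Fin n) ℝ}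
  {d : ℕ} {ρ δ : ℝ} {k : ℕ} {T : ℕ → ℝ} {x : ℝ → Fin n → ℝ} {y : ℝ → Fin m → ℝ}

lemma of_le (h : IsRun K f A d ρ δ k T x y) {l : ℕ} (hl : l ≤ k) : IsRun K f A d ρ δ l T x y :=
  ⟨h.time_zero, h.x_zero, h.y_zero, fun t ht => h.round t (ht.trans_le hl)⟩

lemma time_le (h : IsRun K f A d ρ δ k T x y) (hk : k ≤ m) {i l : ℕ} (hil : i ≤ l) (hl : l ≤ k) :
    T i ≤ T l := by
  induction l, hil using Nat.le_induction with
  | base => exact le_rfl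
  | succ l hil ih =>
    exact (ih (by omega)).trans (h.round ⟨l, by omega⟩ (by simpa using hl)).le

lemma time_nonneg (h : IsRun K f A d ρ δ k T x y) (hk : k ≤ m) {l : ℕ} (hl : l ≤ k) : 0 ≤ T l := by
  rw [← h.time_zero]
  exact h.time_le hk (Nat.zero_le l) hl

lemma x_mono_and_nonneg (h : IsRun K f A d ρ δ k T x y) (hA : IsInstance A d ρ) (hk : k ≤ m) :
    MonotoneOn x (Icc 0 (T k)) ∧ ∀ τ ∈ Icc 0 (T k), 0 ≤ x τ := by
  induction k with
  | zero =>
    rw [h.time_zero, Icc_self]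
    exact ⟨subsingleton_singleton.monotoneOn x, fun τ hτ => by rw [hτ, h.x_zero]⟩
  | succ k ih =>
    obtain ⟨h1, h2⟩ := ih (h.of_le k.le_succ) (by omega)
    have h0 := (h.time_nonneg hk (l := k) k.le_succ)
    have hr := h.round ⟨k, by omega⟩ (by simp)
    have hxk := h2 _ (right_mem_Icc.2 h0)
    rw [← Icc_union_Icc_eq_Icc h0 hr.le]
    refine ⟨h1.union_right (hr.x_mono hA hxk) (isGreatest_Icc h0) (isLeast_Icc hr.le), ?_⟩
    rintro τ (hτ | hτ)
    · exact h2 τ hτ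
    · exact hr.x_nonneg hA hxk hτ

lemma x_nonneg_time (h : IsRun K f A d ρ δ k T x y) (hA : IsInstance A d ρ) (hk : k ≤ m) {l : ℕ}
    (hl : l ≤ k) : 0 ≤ x (T l) :=
  (h.x_mono_and_nonneg hA hk).2 _ ⟨h.time_nonneg hk hl, h.time_le hk hl le_rfl⟩

lemma y_mono (h : IsRun K f A d ρ δ k T x y) (hf : IsCostFunction K f) (hA : IsInstance A d ρ)
    (hδ : 0 < δ) (hk : k ≤ m) : MonotoneOn y (Icc 0 (T k)) := by
  induction k with
  | zero =>
    rw [h.time_zero, Icc_self]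
    exact subsingleton_singleton.monotoneOn y
  | succ k ih =>
    have h0 := (h.time_nonneg hk (l := k) k.le_succ)
    have hr := h.round ⟨k, by omega⟩ (by simp)
    rw [← Icc_union_Icc_eq_Icc h0 hr.le]
    exact (ih (h.of_le k.le_succ) (by omega)).union_right
      (hr.y_mono hf hA hδ (h.x_nonneg_time hA hk k.le_succ)) (isGreatest_Icc h0) (isLeast_Icc hr.le)

lemma mu_mono (h : IsRun K f A d ρ δ k T x y) (hf : IsCostFunction K f) (hA : IsInstance A d ρ)
    (hδ : 0 < δ) (hk : k ≤ m) : MonotoneOn (fun τ => dualMu K f δ (x τ)) (Icc 0 (T k)) := by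
  obtain ⟨h1, h2⟩ := h.x_mono_and_nonneg hA hk
  exact fun a ha b hb hab j => hf.grad_mono_of_nonneg (smul_nonneg hδ.le (h2 a ha))
    (smul_le_smul_of_nonneg_left (h1 ha hb hab) hδ.le) j

lemma covered (h : IsRun K f A d ρ δ k T x y) (hA : IsInstance A d ρ) (hk : k ≤ m) (i : Fin m)
    (hi : (i : ℕ) < k) {τ : ℝ} (hτ : τ ∈ Icc (T (i + 1)) (T k)) : 1 ≤ ∑ j, A i j * x τ j := by
  have h0 := h.time_nonneg hk (Nat.succ_le_of_lt hi)
  refine (h.round i hi).satisfied.trans (Finset.sum_le_sum fun j _ =>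
    mul_le_mul_of_nonneg_left ?_ (hA.nonneg i j))
  exact (h.x_mono_and_nonneg hA hk).1 ⟨h0, hτ.1.trans hτ.2⟩ ⟨h0.trans hτ.1, hτ.2⟩ hτ.1 j

lemma load_le (h : IsRun K f A d ρ δ k T x y) (hf : IsCostFunction K f) (hA : IsInstance A d ρ)
    (hδ : 0 < δ) (hk : k ≤ m) {j : Fin n} {b : ℝ} (hb : ∀ i, A i j ≤ b)
    (hb' : ∀ i, 0 < A i j → b ≤ ρ * A i j) (hρ : 0 ≤ ρ) :
    ∀ τ ∈ Icc 0 (T k), b * x τ j ≤ ρ ∧ ∑ i, A i j * y τ i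
      ≤ gradCoord K f j (δ • x τ) / Real.log (1 + d * ρ) * Real.log (1 + d * b * x τ j) := by
  induction k with
  | zero =>
    intro τ hτ
    rw [h.time_zero, Icc_self] at hτ
    rw [hτ, h.x_zero, h.y_zero]
    simpa using hρ
  | succ k ih =>
    have h0 := (h.time_nonneg hk (l := k) k.le_succ)
    have hr := h.round ⟨k, by omega⟩ (by simp)
    have ih := ih (h.of_le k.le_succ) (by omega)
    have hxk := h.x_nonneg_time hA hk k.le_succ
    obtain ⟨h1, h2⟩ := ih _ (right_mem_Icc.2 h0)
    rw [← Icc_union_Icc_eq_Icc h0 hr.le]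
    rintro τ (hτ | hτ)
    · exact ih τ hτ
    · exact ⟨hr.scaled_le hA hxk hb' h1 hτ, hr.load_le hf hA hδ hxk hb h2 hτ⟩

lemma dualFeasible (h : IsRun K f A d ρ δ k T x y) (hf : IsCostFunction K f)
    (hA : IsInstance A d ρ) (hδ : 0 < δ) (hk : k ≤ m) {τ : ℝ} (hτ : τ ∈ Icc 0 (T k)) :
    DualFeasible A (y τ) (dualMu K f δ (x τ)) := by
  have hx := (h.x_mono_and_nonneg hA hk).2 τ hτ
  refine ⟨fun i => ?_, fun j => ?_⟩
  · have := h.y_mono hf hA hδ hk (left_mem_Icc.2 (hτ.1.trans hτ.2)) hτ hτ.1 i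
    rwa [h.y_zero] at this
  · have hg := hf.grad_nonneg (smul_nonneg hδ.le hx) j
    -- Without rows `log (1 + d * ρ)` need not be positive, but the load is an empty sum.
    rcases isEmpty_or_nonempty (Fin m) with hm | ⟨⟨i₀⟩⟩
    · simpa [dualMu] using hg
    · obtain ⟨i, -, hi⟩ := Finset.exists_max_image Finset.univ (fun i => A i j)
        ⟨i₀, Finset.mem_univ i₀⟩
      have hρ : 0 ≤ ρ := zero_le_one.trans (hA.one_le_rho i)
      have hL := hA.log_pos i
      obtain ⟨h1, h2⟩ := h.load_le hf hA hδ hk (fun k => hi k (Finset.mem_univ k))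
        (fun k hk => hA.col_ratio i k j hk) hρ τ hτ
      refine h2.trans ?_
      rw [div_mul_eq_mul_div, div_le_iff₀ hL]
      refine mul_le_mul_of_nonneg_left (Real.log_le_log ?_ ?_) hg
      · have := mul_nonneg (mul_nonneg (Nat.cast_nonneg' d (α := ℝ)) (hA.nonneg i j)) (hx j)
        linarith
      · rw [mul_assoc]
        gcongr

/-- The primal objective is at most twice the elapsed time. -/
lemma primal_le (h : IsRun K f A d ρ δ k T x y) (hf : IsCostFunction K f)
    (hA : IsInstance A d ρ) (hk : k ≤ m) : f (x (T k)) ≤ 2 * T k := by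
  induction k with
  | zero => rw [h.time_zero, h.x_zero, hf.zero]; simp
  | succ k ih =>
    have := (h.round ⟨k, by omega⟩ (by simp)).primal_increment_le hf hA
      (h.x_nonneg_time hA hk k.le_succ)
    have := ih (h.of_le k.le_succ) (by omega)
    linarith

lemma le_sum_y (h : IsRun K f A d ρ δ k T x y) (hA : IsInstance A d ρ) (hk : k ≤ m)
    {r : ℝ} (hr : ∀ z : Fin n → ℝ, 0 ≤ z → ∀ ℓ, 0 < gradCoord K f ℓ z →
      r ≤ gradCoord K f ℓ (δ • z) / gradCoord K f ℓ z) :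
    r / Real.log (1 + d * ρ) * T k ≤ ∑ i, y (T k) i := by
  induction k with
  | zero => rw [h.time_zero, h.y_zero]; simp
  | succ k ih =>
    have hr' := h.round ⟨k, by omega⟩ (by simp)
    have h1 := hr'.le_y_increment hA (h.x_nonneg_time hA hk k.le_succ) hr
    have h2 := ih (h.of_le k.le_succ) (by omega)
    have h3 : ∑ i, (y (T (k + 1)) i - y (T k) i)
        = y (T (k + 1)) ⟨k, by omega⟩ - y (T k) ⟨k, by omega⟩ :=
      Finset.sum_eq_single _
        (fun i _ hi => sub_eq_zero.2 (hr'.y_const _ (right_mem_Icc.2 hr'.le) i hi))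
        fun h => absurd (Finset.mem_univ _) h
    rw [Finset.sum_sub_distrib] at h3
    simp only at h1
    linarith

/-- A run with at least one round ends at a point of positive cost, which is seen by some partial
derivative. -/
lemma cost_pos (h : IsRun K f A d ρ δ k T x y) (hf : IsCostFunction K f)
    (hA : IsInstance A d ρ) (hk : k ≤ m) (hk0 : 0 < k) :
    0 < f (x (T k)) ∧ ∃ j, 0 < gradCoord K f j (x (T k)) := by
  have hr := h.round ⟨0, by omega⟩ hk0
  simp only [zero_add] at hr
  have h01 : T 0 < T 1 := by
    refine hr.le.lt_of_ne fun h01 => ?_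
    have := hr.satisfied
    rw [← h01, h.time_zero, h.x_zero] at this
    simp at this
    linarith
  obtain ⟨j, hj⟩ := hA.satisfiable ⟨0, by omega⟩
  -- Two interior times are used because the gradient may vanish at `T 0`. At `σ` it is positive in
  -- direction `j`, and `x_j` grows strictly up to `τ`, so the gradient inequality forces `f (x τ) >
  -- f (x σ) ≥ 0`.
  obtain ⟨σ, hσ⟩ := exists_between h01
  obtain ⟨τ, hτ⟩ := exists_between hσ.2
  have hx0 : 0 ≤ x (T 0) := h.x_nonneg_time hA hk (Nat.zero_le k)
  have hστ : σ < τ := hτ.1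
  have hσ' : σ ∈ Icc (T 0) (T 1) := ⟨hσ.1.le, hσ.2.le⟩
  have hτ' : τ ∈ Icc (T 0) (T 1) := ⟨(hσ.1.trans hτ.1).le, hτ.2.le⟩
  have hxσ := hr.x_nonneg hA hx0 hσ'
  have hxτ := hr.x_nonneg hA hx0 hτ'
  have hd : (0 : ℝ) < d := by exact_mod_cast hA.one_le_d ⟨0, by omega⟩
  have hstrict : x σ j < x τ j := by
    refine strictMonoOn_of_deriv_pos (convex_Icc σ τ) (f := fun r => x r j)
      ((hr.coord_continuous j).mono (Icc_subset_Icc hσ'.1 hτ'.2)) (fun r hr' => ?_)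
      (left_mem_Icc.2 hστ.le) (right_mem_Icc.2 hστ.le) hστ
    rw [interior_Icc] at hr'
    have hr2 : r ∈ Ioo (T 0) (T 1) := ⟨hσ.1.trans hr'.1, hr'.2.trans hτ.2⟩
    rw [(hr.x_rate r hr2 j hj).deriv]
    have := hr.x_nonneg hA hx0 (Ioo_subset_Icc_self hr2) j
    simp only [Pi.zero_apply] at this
    exact div_pos (by positivity) (hr.grad_pos r hr2 j hj)
  have hlast : x τ ≤ x (T k) := by
    have h1k := h.time_le hk (Nat.succ_le_of_lt hk0) le_rfl
    have h00 := h.time_zero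
    exact (h.x_mono_and_nonneg hA hk).1 ⟨by linarith [hτ'.1], hτ'.2.trans h1k⟩
      ⟨h.time_nonneg hk le_rfl, le_rfl⟩ (hτ'.2.trans h1k)
  have hgσ := hr.grad_pos σ ⟨hσ.1, hσ.2⟩ j hj
  have hxk := hxσ.trans ((hr.x_mono hA hx0 hσ' hτ' hστ.le).trans hlast)
  refine ⟨?_, j, hgσ.trans_le (hf.grad_mono_of_nonneg hxσ
    ((hr.x_mono hA hx0 hσ' hτ' hστ.le).trans hlast) j)⟩
  have hgi := hf.gradient_inequality (hf.mem _ hxσ) (hf.mem _ hxτ)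
  have hpos : 0 < ∑ i, gradCoord K f i (x σ) * (x τ i - x σ i) :=
    Finset.sum_pos' (fun i _ => mul_nonneg (hf.grad_nonneg hxσ i)
      (sub_nonneg.2 (hr.x_mono hA hx0 hσ' hτ' hστ.le i)))
      ⟨j, Finset.mem_univ j, mul_pos hgσ (sub_pos.2 hstrict)⟩
  have := hf.nonneg _ (hf.mem _ hxσ)
  exact lt_of_lt_of_le (by linarith) (hf.mono (hf.mem _ hxτ) (hf.mem _ hxk) hlast)

end IsRun

/-! ### The competitive ratio -/

section Competitive

variable {n : ℕ} {K : Set (Fin n → ℝ)} {f : (Fin n → ℝ) → ℝ}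

lemma dualObjective_dualMu (hf : IsCostFunction K f) {m : ℕ} {δ : ℝ} (hδ : 0 < δ)
    {x : Fin n → ℝ} (hx : 0 ≤ x) (y : Fin m → ℝ) :
    dualObjective K f y (dualMu K f δ x) = ((∑ i, y i
      - (∑ j, (δ • x) j * gradCoord K f j (δ • x) - f (δ • x)) : ℝ) : EReal) := by
  rw [EReal.coe_sub, ← hf.fenchelDual_grad (hf.mem _ (smul_nonneg hδ.le hx))]
  rfl

lemma ratioAt_mul_le (hf : IsCostFunction K f) {d : ℕ} {ρ c : ℝ} (hc : 0 < c) {m : ℕ}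
    {A : Matrix (Fin m) (Fin n) ℝ} (hA : IsInstance A d ρ) {T : ℕ → ℝ} {x : ℝ → Fin n → ℝ}
    {y : ℝ → Fin m → ℝ} (h : IsRun K f A d ρ (1 / c) m T x y) :
    ratioAt K f d ρ c * ((f (x (T m)) : ℝ) : EReal)
      ≤ dualObjective K f (y (T m)) (dualMu K f (1 / c) (x (T m))) := by
  have hδ : 0 < 1 / c := one_div_pos.2 hc
  have hx : 0 ≤ x (T m) := h.x_nonneg_time hA le_rfl le_rfl
  rw [dualObjective_dualMu hf hδ hx]
  -- Without rows both sides vanish, since a product with `0` in `EReal` is `0` even for an infinite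
  -- ratio.
  rcases Nat.eq_zero_or_pos m with rfl | hm
  · simp [h.time_zero, h.x_zero, hf.zero]
  -- Positive cost and a positive partial derivative put the final point `z = x / c` into the ranges
  -- of the supremum and the infimum, so `R` is finite and `S` is not `⊥`. If `S = ⊤`, the ratio is
  -- `⊥` and the bound is trivial.
  obtain ⟨hF, j, hj⟩ := h.cost_pos hf hA le_rfl hm
  have hL := hA.log_pos ⟨0, hm⟩
  have hcx : c • ((1 / c) • x (T m)) = x (T m) := by rw [smul_smul, mul_one_div_cancel hc.ne', one_smul]
  have hz : 0 ≤ (1 / c) • x (T m) := smul_nonneg hδ.le hx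
  unfold ratioAt
  set R : EReal := ⨅ (z : Fin n → ℝ) (_ : 0 ≤ z) (ℓ : Fin n) (_ : 0 < gradCoord K f ℓ (c • z)),
      ((gradCoord K f ℓ z / gradCoord K f ℓ (c • z) : ℝ) : EReal) with hR
  set S : EReal := ⨆ (z : Fin n → ℝ) (_ : 0 ≤ z) (_ : 0 < f (c • z)),
      (((∑ j, z j * gradCoord K f j z - f z) / f (c • z) : ℝ) : EReal) with hS
  have hRle : ∀ z : Fin n → ℝ, 0 ≤ z → ∀ ℓ, 0 < gradCoord K f ℓ (c • z) →
      R ≤ ((gradCoord K f ℓ z / gradCoord K f ℓ (c • z) : ℝ) : EReal) := fun z hz ℓ hℓ =>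
    (iInf₂_le z hz).trans (iInf₂_le ℓ hℓ)
  have hR0 : 0 ≤ R := le_iInf₂ fun z hz => le_iInf₂ fun ℓ hℓ =>
    EReal.coe_nonneg.2 (div_nonneg (hf.grad_nonneg hz ℓ) hℓ.le)
  have hleS : (((∑ j, ((1 / c) • x (T m)) j * gradCoord K f j ((1 / c) • x (T m))
      - f ((1 / c) • x (T m))) / f (x (T m)) : ℝ) : EReal) ≤ S := by
    have := le_iSup₂_of_le (f := fun (z : Fin n → ℝ) (_ : 0 ≤ z) => ⨆ (_ : 0 < f (c • z)),
      (((∑ j, z j * gradCoord K f j z - f z) / f (c • z) : ℝ) : EReal)) _ hz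
      (le_iSup_of_le (by rwa [hcx]) le_rfl)
    rwa [hcx] at this
  have hRtop : R ≠ ⊤ := ne_top_of_le_ne_top (EReal.coe_ne_top _)
    (hRle _ hz j (by rwa [hcx]))
  have hRbot : R ≠ ⊥ := (lt_of_lt_of_le EReal.bot_lt_zero hR0).ne'
  have hSbot : S ≠ ⊥ := (lt_of_lt_of_le (EReal.bot_lt_coe _) hleS).ne'
  clear_value R S
  lift R to ℝ using ⟨hRtop, hRbot⟩
  induction S with
  | bot => exact absurd rfl hSbot
  | top =>
    rw [EReal.sub_top, EReal.bot_mul_coe_of_pos hF]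
    exact bot_le
  | coe S =>
    rw [← EReal.coe_div, ← EReal.coe_sub, ← EReal.coe_mul, EReal.coe_le_coe_iff]
    -- Substituting `z / c` for `z` turns the infimum `R` into a lower bound for the minimum in the
    -- dual rate with `δ = 1 / c`.
    have h1 := h.le_sum_y hA le_rfl (r := R) fun z hz ℓ hℓ => by
      have hcz : c • ((1 / c) • z) = z := by rw [smul_smul, mul_one_div_cancel hc.ne', one_smul]
      have := hRle ((1 / c) • z) (smul_nonneg hδ.le hz) ℓ (by rwa [hcz])
      rw [hcz] at this
      exact_mod_cast this
    have h2 := h.primal_le hf hA le_rfl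
    have h3 : R / (2 * Real.log (1 + ρ * d)) * f (x (T m)) ≤ R / Real.log (1 + d * ρ) * T m := by
      rw [mul_comm ρ, div_mul_eq_mul_div, div_mul_eq_mul_div, div_le_div_iff₀ (by positivity) hL]
      have : 0 ≤ R * Real.log (1 + d * ρ) := mul_nonneg (by exact_mod_cast hR0) hL.le
      nlinarith
    rw [EReal.coe_le_coe_iff, div_le_iff₀ hF] at hleS
    rw [sub_mul]
    linarith

lemma isCompetitive_of_le_ratioAt (hf : IsCostFunction K f) {d : ℕ} {ρ c : ℝ} (hc : 0 < c)
    {β : EReal} (hβ : β ≤ ratioAt K f d ρ c) : IsCompetitive K f d ρ (1 / c) β := by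
  intro m A hA T x y h
  have hx : 0 ≤ x (T m) := h.x_nonneg_time hA le_rfl le_rfl
  have hF : (0 : EReal) ≤ ((f (x (T m)) : ℝ) : EReal) :=
    EReal.coe_nonneg.2 (hf.nonneg _ (hf.mem _ hx))
  have key := (mul_le_mul_of_nonneg_right hβ hF).trans (ratioAt_mul_le hf hc hA h)
  refine ⟨key, fun hβ0 y' μ' hfeas => le_trans (mul_le_mul_of_nonneg_left ?_ hβ0) key⟩
  exact dualObjective_le (hf.mem _ hx) hx (fun i => h.covered hA le_rfl i i.2
    ⟨h.time_le le_rfl (Nat.succ_le_of_lt i.2) le_rfl, le_rfl⟩) hfeas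

end Competitive

/-! ### Peano's theorem by Euler polygons -/

section Peano

variable {E : Type*} [NormedAddCommGroup E] [NormedSpace ℝ E]

/-- A pointwise limit of functions whose increments at `τ₀` are nearly linear is differentiable at
`τ₀`. -/
lemma hasDerivAt_of_tendsto_of_increments {α : Type*} {U : Filter α} [U.NeBot] {X : α → ℝ → E}
    {x : ℝ → E} {τ₀ : ℝ} {v : E}
    (hlim : ∀ᶠ τ in 𝓝 τ₀, Tendsto (fun k => X k τ) U (𝓝 (x τ)))
    (h : ∀ η : ℝ, 0 < η → ∃ err : α → ℝ, Tendsto err U (𝓝 0) ∧ ∀ᶠ τ in 𝓝 τ₀, ∀ᶠ k in U,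
      ‖X k τ - X k τ₀ - (τ - τ₀) • v‖ ≤ η * |τ - τ₀| + err k) :
    HasDerivAt x v τ₀ := by
  rw [hasDerivAt_iff_isLittleO]
  refine Asymptotics.IsLittleO.of_bound fun η hη => ?_
  obtain ⟨err, herr, hev⟩ := h η hη
  filter_upwards [hlim, hev] with τ hτ hk
  have h0 := hlim.self_of_nhds
  refine le_of_tendsto_of_tendsto ((hτ.sub h0).sub_const _).norm ?_ hk
  simpa using herr.const_add (η * |τ - τ₀|)

/-- Euler's polygon with step `1 / M`. -/
noncomputable def eulerSeq (F : E → E) (x₀ : E) (M : ℝ) : ℕ → E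
  | 0 => x₀
  | i + 1 => eulerSeq F x₀ M i + (1 / M) • F (eulerSeq F x₀ M i)

/-- Each step deviates from `v / M` by at most `η / M`, and the deviations add up. The case `v = 0`
gives Lipschitz bounds; `v = F (x τ₀)` gives differentiability of the limit. -/
lemma eulerSeq_increment_of_le (F : E → E) (x₀ v : E) {M η : ℝ} (hM : 0 < M) {a b : ℕ}
    (hab : a ≤ b) (h : ∀ i, a ≤ i → i ≤ b → ‖F (eulerSeq F x₀ M i) - v‖ ≤ η) :
    ‖eulerSeq F x₀ M b - eulerSeq F x₀ M a - (((b : ℝ) - a) / M) • v‖ ≤ η * (((b : ℝ) - a) / M) := by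
  induction b, hab using Nat.le_induction with
  | base => simp
  | succ b hab ih =>
    have ih := ih fun i h1 h2 => h i h1 (h2.trans b.le_succ)
    have hb := h b hab b.le_succ
    have : eulerSeq F x₀ M (b + 1) - eulerSeq F x₀ M a - ((((b + 1 : ℕ) : ℝ) - a) / M) • v
        = (eulerSeq F x₀ M b - eulerSeq F x₀ M a - (((b : ℝ) - a) / M) • v)
          + (1 / M) • (F (eulerSeq F x₀ M b) - v) := by
      have e : (((b + 1 : ℕ) : ℝ) - a) / M = ((b : ℝ) - a) / M + 1 / M := by
        push_cast; ring
      rw [e, eulerSeq, add_smul, smul_sub]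
      abel
    rw [this]
    refine (norm_add_le _ _).trans ?_
    rw [norm_smul, Real.norm_of_nonneg (by positivity : 0 ≤ 1 / M)]
    have h2 : 1 / M * ‖F (eulerSeq F x₀ M b) - v‖ ≤ 1 / M * η :=
      mul_le_mul_of_nonneg_left hb (by positivity)
    calc _ ≤ η * (((b : ℝ) - a) / M) + 1 / M * η := add_le_add ih h2
      _ = _ := by push_cast; ring

lemma eulerSeq_increment (F : E → E) (x₀ v : E) {M η : ℝ} (hM : 0 < M) (a b : ℕ)
    (h : ∀ i ∈ uIcc a b, ‖F (eulerSeq F x₀ M i) - v‖ ≤ η) :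
    ‖eulerSeq F x₀ M b - eulerSeq F x₀ M a - (((b : ℝ) - a) / M) • v‖ ≤ η * (|(b : ℝ) - a| / M) := by
  rcases le_total a b with hab | hab
  · rw [uIcc_of_le hab] at h
    rw [abs_of_nonneg (sub_nonneg.2 (by exact_mod_cast hab))]
    exact eulerSeq_increment_of_le F x₀ v hM hab fun i h1 h2 => h i ⟨h1, h2⟩
  · rw [uIcc_of_ge hab] at h
    rw [abs_sub_comm, abs_of_nonneg (sub_nonneg.2 (by exact_mod_cast hab))]
    refine le_of_eq_of_le ?_
      (eulerSeq_increment_of_le F x₀ v hM hab fun i h1 h2 => h i ⟨h1, h2⟩)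
    rw [← norm_neg]
    congr 1
    rw [← neg_sub (a : ℝ) b, neg_div, neg_smul]
    abel

lemma abs_floor_sub_floor_le {M : ℝ} (hM : 0 < M) {σ τ : ℝ} (hσ : 0 ≤ σ) (hτ : 0 ≤ τ) :
    |((⌊M * τ⌋₊ : ℝ) - ⌊M * σ⌋₊) / M - (τ - σ)| ≤ 1 / M := by
  have h1 := Nat.floor_le (mul_nonneg hM.le hσ)
  have h2 := Nat.lt_floor_add_one (M * σ)
  have h3 := Nat.floor_le (mul_nonneg hM.le hτ)
  have h4 := Nat.lt_floor_add_one (M * τ)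
  have e : ((⌊M * τ⌋₊ : ℝ) - ⌊M * σ⌋₊) / M - (τ - σ)
      = (((⌊M * τ⌋₊ : ℝ) - ⌊M * σ⌋₊) - (M * τ - M * σ)) / M := by field_simp
  rw [e, abs_div, abs_of_pos hM]
  refine div_le_div_of_nonneg_right (abs_le.2 ⟨?_, ?_⟩) hM.le <;> linarith

/-- **Peano's existence theorem** for a bounded continuous autonomous vector field. -/
theorem exists_hasDerivAt_of_continuous_of_bounded [ProperSpace E] {F : E → E} (hF : Continuous F)
    {C : ℝ} (hC : ∀ u, ‖F u‖ ≤ C) (x₀ : E) :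
    ∃ x : ℝ → E, x 0 = x₀ ∧ ContinuousOn x (Ici 0) ∧ ∀ τ, 0 < τ → HasDerivAt x (F (x τ)) τ := by
  have hC0 : 0 ≤ C := (norm_nonneg _).trans (hC 0)
  -- An ultrafilter selects limits at all times simultaneously, replacing the Arzelà–Ascoli theorem.
  set U : Ultrafilter ℕ := hyperfilter ℕ
  have hU : (U : Filter ℕ) ≤ atTop := Nat.hyperfilter_le_atTop
  set M : ℕ → ℝ := fun k => (k : ℝ) + 1 with hMdef
  have hM : ∀ k, 0 < M k := fun k => by positivity
  have hMlim : Tendsto (fun k => 1 / M k) U (𝓝 0) := tendsto_one_div_add_atTop_nhds_zero_nat.mono_left hU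
  set X : ℕ → ℝ → E := fun k τ => eulerSeq F x₀ (M k) ⌊M k * τ⌋₊ with hX
  have hLip : ∀ k a b, ‖eulerSeq F x₀ (M k) b - eulerSeq F x₀ (M k) a‖
      ≤ C * (|(b : ℝ) - a| / M k) := fun k a b => by
    simpa using eulerSeq_increment F x₀ 0 (hM k) a b fun i _ => by simpa using hC _
  have hX0 : ∀ k τ, 0 ≤ τ → ‖X k τ - x₀‖ ≤ C * τ := fun k τ hτ => by
    refine (hLip k 0 _).trans (mul_le_mul_of_nonneg_left ?_ hC0)
    rw [Nat.cast_zero, sub_zero, Nat.abs_cast, div_le_iff₀' (hM k)]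
    exact Nat.floor_le (mul_nonneg (hM k).le hτ)
  have hex : ∀ τ, ∃ p, 0 ≤ τ → Tendsto (fun k => X k τ) U (𝓝 p) := by
    intro τ
    by_cases hτ : 0 ≤ τ
    · obtain ⟨p, -, hp⟩ := (isCompact_closedBall x₀ (C * τ)).ultrafilter_le_nhds'
        (U.map fun k => X k τ) (Ultrafilter.mem_map.2 (Filter.univ_mem' fun k => by
          simpa [dist_eq_norm] using hX0 k τ hτ))
      exact ⟨p, fun _ => hp⟩
    · exact ⟨0, fun h => absurd h hτ⟩
  choose x hx using hex
  have hbound : ∀ τ, 0 ≤ τ → ‖x τ - x₀‖ ≤ C * τ := fun τ hτ =>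
    le_of_tendsto ((hx τ hτ).sub_const x₀).norm (.of_forall fun k => hX0 k τ hτ)
  have hx0 : x 0 = x₀ := by
    have := hbound 0 le_rfl
    rw [mul_zero] at this
    exact sub_eq_zero.1 (norm_le_zero_iff.1 this)
  have hder : ∀ τ, 0 < τ → HasDerivAt x (F (x τ)) τ := by
    intro τ₀ hτ₀
    refine hasDerivAt_of_tendsto_of_increments (U := (U : Filter ℕ)) (X := X) ?_ ?_
    · filter_upwards [lt_mem_nhds hτ₀] with τ hτ using hx τ hτ.le
    intro η hη
    refine ⟨fun k => (η + ‖F (x τ₀)‖) * (1 / M k), by simpa using hMlim.const_mul _, ?_⟩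
    obtain ⟨r, hr, hFr⟩ := Metric.continuousAt_iff.1 (hF.continuousAt (x := x τ₀)) η hη
    have h1 : ∀ᶠ τ in 𝓝 τ₀, C * |τ - τ₀| < r / 2 := by
      have : Tendsto (fun τ => C * |τ - τ₀|) (𝓝 τ₀) (𝓝 (C * |τ₀ - τ₀|)) :=
        (continuous_const.mul (continuous_id.sub continuous_const).abs).tendsto τ₀
      rw [sub_self, abs_zero, mul_zero] at this
      exact this.eventually (gt_mem_nhds (half_pos hr))
    filter_upwards [h1, lt_mem_nhds hτ₀] with τ hτ hτ0
    have h2 : ∀ᶠ k in (U : Filter ℕ), C * (1 / M k) + ‖X k τ₀ - x τ₀‖ < r / 2 := by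
      have : Tendsto (fun k => C * (1 / M k) + ‖X k τ₀ - x τ₀‖) U
          (𝓝 (C * 0 + ‖x τ₀ - x τ₀‖)) :=
        (hMlim.const_mul C).add ((hx τ₀ hτ₀.le).sub_const _).norm
      rw [sub_self, norm_zero, mul_zero, add_zero] at this
      exact this.eventually (gt_mem_nhds (half_pos hr))
    filter_upwards [h2] with k hk
    have hfl := abs_floor_sub_floor_le (hM k) hτ₀.le hτ0.le
    set a := ⌊M k * τ₀⌋₊ with ha
    set b := ⌊M k * τ⌋₊ with hb
    have hba : |(b : ℝ) - a| / M k ≤ |τ - τ₀| + 1 / M k := by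
      rw [← abs_of_pos (hM k), ← abs_div, abs_of_pos (hM k)]
      have := abs_sub_abs_le_abs_sub (((b : ℝ) - a) / M k) (τ - τ₀)
      linarith
    -- By the Lipschitz bound all nodes between the two times lie within `r` of `x τ₀`, where `F`
    -- varies by less than `η`.
    have hnear : ∀ i ∈ uIcc a b, ‖F (eulerSeq F x₀ (M k) i) - F (x τ₀)‖ ≤ η := by
      intro i hi
      rw [← dist_eq_norm]
      refine (hFr ?_).le
      rw [dist_eq_norm]
      have hia : |(i : ℝ) - a| ≤ |(b : ℝ) - a| :=
        abs_sub_left_of_mem_uIcc (by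
          rcases mem_uIcc.1 hi with h | h
          · exact mem_uIcc.2 (Or.inl ⟨by exact_mod_cast h.1, by exact_mod_cast h.2⟩)
          · exact mem_uIcc.2 (Or.inr ⟨by exact_mod_cast h.1, by exact_mod_cast h.2⟩))
      have h3 : C * (|(i : ℝ) - a| / M k) ≤ C * (|τ - τ₀| + 1 / M k) :=
        mul_le_mul_of_nonneg_left
          ((div_le_div_of_nonneg_right hia (hM k).le).trans hba) hC0
      calc ‖eulerSeq F x₀ (M k) i - x τ₀‖
          ≤ ‖eulerSeq F x₀ (M k) i - eulerSeq F x₀ (M k) a‖ + ‖X k τ₀ - x τ₀‖ := norm_sub_le_norm_sub_add_norm_sub _ _ _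
        _ ≤ C * (|τ - τ₀| + 1 / M k) + ‖X k τ₀ - x τ₀‖ := by
          gcongr
          exact (hLip k a i).trans h3
        _ < r := by linarith
    have h4 := eulerSeq_increment F x₀ (F (x τ₀)) (hM k) a b hnear
    have h5 : X k τ - X k τ₀ - (τ - τ₀) • F (x τ₀)
        = (eulerSeq F x₀ (M k) b - eulerSeq F x₀ (M k) a - (((b : ℝ) - a) / M k) • F (x τ₀))
          + (((b : ℝ) - a) / M k - (τ - τ₀)) • F (x τ₀) := by
      rw [sub_smul (((b : ℝ) - a) / M k) (τ - τ₀)]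
      simp only [hX, ← ha, ← hb]
      abel
    rw [h5]
    refine (norm_add_le _ _).trans ?_
    rw [norm_smul, Real.norm_eq_abs]
    calc _ ≤ η * (|τ - τ₀| + 1 / M k) + 1 / M k * ‖F (x τ₀)‖ :=
          add_le_add (h4.trans (mul_le_mul_of_nonneg_left hba hη.le))
            (mul_le_mul_of_nonneg_right hfl (norm_nonneg _))
      _ = _ := by ring
  refine ⟨x, hx0, fun τ hτ => ?_, hder⟩
  rcases (mem_Ici.1 hτ).eq_or_lt with rfl | hτ
  · rw [ContinuousWithinAt, hx0, tendsto_iff_norm_sub_tendsto_zero]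
    refine squeeze_zero' (.of_forall fun _ => norm_nonneg _)
      (by filter_upwards [self_mem_nhdsWithin] with τ hτ using hbound τ hτ) ?_
    have : Tendsto (fun τ : ℝ => C * τ) (𝓝[≥] 0) (𝓝 (C * 0)) :=
      (continuous_const.mul continuous_id).continuousWithinAt
    rwa [mul_zero] at this
  · exact (hder τ hτ).continuousAt.continuousWithinAt

end Peano

lemma increment_mem_Icc_of_hasDerivAt {u u' : ℝ → ℝ} {s e lo hi : ℝ} (hse : s ≤ e)
    (hc : ContinuousOn u (Icc s e)) (hd : ∀ τ ∈ Ioo s e, HasDerivAt u (u' τ) τ)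
    (hlo : ∀ τ ∈ Ioo s e, lo ≤ u' τ) (hhi : ∀ τ ∈ Ioo s e, u' τ ≤ hi) :
    u e - u s ∈ Icc (lo * (e - s)) (hi * (e - s)) := by
  have h1 := monotoneOn_Icc_of_hasDerivAt_nonneg (u := fun τ => u τ - lo * τ)
    (hc.sub (continuousOn_const.mul continuousOn_id))
    (fun τ hτ => (hd τ hτ).sub ((hasDerivAt_id τ).const_mul lo))
    (fun τ hτ => by have := hlo τ hτ; linarith) (left_mem_Icc.2 hse) (right_mem_Icc.2 hse) hse
  have h2 := monotoneOn_Icc_of_hasDerivAt_nonneg (u := fun τ => hi * τ - u τ)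
    ((continuousOn_const.mul continuousOn_id).sub hc)
    (fun τ hτ => ((hasDerivAt_id τ).const_mul hi).sub (hd τ hτ))
    (fun τ hτ => by have := hhi τ hτ; linarith) (left_mem_Icc.2 hse) (right_mem_Icc.2 hse) hse
  simp only at h1 h2
  constructor <;> linarith

/-! ### Trajectories of the truncated velocity field -/

section Velocity

variable {n : ℕ}

/-- The velocity that a row `a` of the covering matrix prescribes at the primal point `z`. -/
noncomputable def velocity (K : Set (Fin n → ℝ)) (f : (Fin n → ℝ) → ℝ) (a : Fin n → ℝ) (b : ℝ)
    (z : Fin n → ℝ) : Fin n → ℝ :=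
  fun j => if 0 < a j then (a j * z j + b) / gradCoord K f j z else 0

/-- The projection onto the box `[s j + ε, M]` in the coordinates active in `a`; the other
coordinates are set to `s j`. -/
noncomputable def boxProj (a s : Fin n → ℝ) (M ε : ℝ) (u : Fin n → ℝ) : Fin n → ℝ :=
  fun j => if 0 < a j then max (s j + ε) (min (u j) M) else s j

lemma continuous_boxProj (a s : Fin n → ℝ) (M ε : ℝ) : Continuous (boxProj a s M ε) := by
  refine continuous_pi fun j => ?_
  unfold boxProj
  split_ifs
  · exact continuous_const.max ((continuous_apply j).min continuous_const)
  · exact continuous_const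

variable {K : Set (Fin n → ℝ)} {f : (Fin n → ℝ) → ℝ} {a s : Fin n → ℝ} {b M : ℝ}

lemma le_boxProj {ε : ℝ} (hε : 0 ≤ ε) (u : Fin n → ℝ) : s ≤ boxProj a s M ε u := by
  intro j
  unfold boxProj
  split_ifs
  · exact (le_add_of_nonneg_right hε).trans (le_max_left _ _)
  · exact le_rfl

lemma boxProj_le {ε : ℝ} (hM : ∀ j, s j + 1 ≤ M) (hε : ε ≤ 1) (u : Fin n → ℝ) (j : Fin n) :
    boxProj a s M ε u j ≤ M := by
  have := hM j
  unfold boxProj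
  split_ifs
  · exact max_le (by linarith) (min_le_right _ _)
  · linarith

lemma continuousAt_velocity (hf : IsCostFunction K f)
    (hpos : ∀ z : Fin n → ℝ, 0 ≤ z → ∀ j, 0 < z j → 0 < gradCoord K f j z) {ε : ℝ} (hs : 0 ≤ s)
    (hε : 0 ≤ ε) {u : Fin n → ℝ} (hu : ∀ j, 0 < a j → 0 < boxProj a s M ε u j) :
    ContinuousAt (fun u => velocity K f a b (boxProj a s M ε u)) u := by
  refine continuousAt_pi.2 fun j => ?_
  unfold velocity
  split_ifs with hj
  · have hc : ContinuousAt (boxProj a s M ε) u := (continuous_boxProj a s M ε).continuousAt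
    have hcj : ContinuousAt (fun u => boxProj a s M ε u j) u := (continuous_apply j).continuousAt.comp hc
    refine ((continuousAt_const.mul hcj).add continuousAt_const).div ?_
      (hpos _ (hs.trans (le_boxProj hε u)) j (hu j hj)).ne'
    refine Tendsto.comp (hf.continuousOn_grad j _ ⟨hs.trans (le_boxProj hε u), hu j hj⟩)
      (tendsto_nhdsWithin_iff.2 ⟨hc, ?_⟩)
    filter_upwards [hcj.eventually (lt_mem_nhds (hu j hj))] with w hw
    exact ⟨hs.trans (le_boxProj hε w), hw⟩
  · exact continuousAt_const

/-- A bound for the `j`-th velocity at the points of the box whose `j`-th coordinate is at least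
`s j + η`. -/
noncomputable def velocityBound (K : Set (Fin n → ℝ)) (f : (Fin n → ℝ) → ℝ) (a s : Fin n → ℝ)
    (b M : ℝ) (j : Fin n) (η : ℝ) : ℝ :=
  (a j * M + b) / gradCoord K f j (Function.update s j (s j + η))

lemma update_nonneg (hs : 0 ≤ s) {η : ℝ} (hη : 0 ≤ η) (j : Fin n) :
    0 ≤ Function.update s j (s j + η) := by
  intro i
  rcases eq_or_ne i j with rfl | h
  · simpa using add_nonneg (hs i) hη
  · simpa [h] using hs i

lemma velocityBound_nonneg (hf : IsCostFunction K f) (hs : 0 ≤ s) (ha : ∀ j, 0 ≤ a j) (hb : 0 ≤ b)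
    (hM : ∀ j, s j + 1 ≤ M) (j : Fin n) {η : ℝ} (hη : 0 ≤ η) :
    0 ≤ velocityBound K f a s b M j η := by
  have : 0 ≤ M := by have := hM j; have := hs j; simp only [Pi.zero_apply] at this; linarith
  exact div_nonneg (add_nonneg (mul_nonneg (ha j) this) hb)
    (hf.grad_nonneg (update_nonneg hs hη j) j)

lemma velocity_nonneg (hf : IsCostFunction K f) (ha : ∀ j, 0 ≤ a j) (hb : 0 ≤ b)
    {z : Fin n → ℝ} (hz : 0 ≤ z) (j : Fin n) : 0 ≤ velocity K f a b z j := by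
  unfold velocity
  split_ifs
  · exact div_nonneg (add_nonneg (mul_nonneg (ha j) (hz j)) hb) (hf.grad_nonneg hz j)
  · exact le_rfl

/-- Every such `z` dominates `Function.update s j (s j + η)`, so monotonicity of the gradient bounds
the denominator from below by a positive number, whatever the other coordinates are. -/
lemma velocity_le (hf : IsCostFunction K f)
    (hpos : ∀ z : Fin n → ℝ, 0 ≤ z → ∀ j, 0 < z j → 0 < gradCoord K f j z) (hs : 0 ≤ s)
    (ha : ∀ j, 0 ≤ a j) (hb : 0 ≤ b) (hM : ∀ j, s j + 1 ≤ M) {z : Fin n → ℝ} (hsz : s ≤ z)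
    {j : Fin n} (hzM : z j ≤ M) {η : ℝ} (hη : 0 < η) (hz : 0 < a j → s j + η ≤ z j) :
    velocity K f a b z j ≤ velocityBound K f a s b M j η := by
  unfold velocity
  split_ifs with hj
  · have hle : Function.update s j (s j + η) ≤ z := by
      intro i
      rcases eq_or_ne i j with rfl | h
      · simpa using hz hj
      · simpa [h] using hsz i
    have hz0 : 0 ≤ z := hs.trans hsz
    have hg := hpos _ (update_nonneg hs hη.le j) j (by
      simpa using add_pos_of_nonneg_of_pos (hs j) hη)
    exact div_le_div₀ (add_nonneg (mul_nonneg hj.le ((hz0 j).trans hzM)) hb)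
      (by gcongr) hg (hf.grad_mono_of_nonneg (update_nonneg hs hη.le j) hle j)
  · exact velocityBound_nonneg hf hs ha hb hM j hη.le

/-- The denominator is at most its value at the corner `(M, …, M)`; this gives linear growth at a
speed independent of the perturbation `ε`. -/
lemma le_velocity (hf : IsCostFunction K f)
    (hpos : ∀ z : Fin n → ℝ, 0 ≤ z → ∀ j, 0 < z j → 0 < gradCoord K f j z) (hb : 0 ≤ b)
    {z : Fin n → ℝ} (hz : 0 ≤ z) (hzM : ∀ i, z i ≤ M) {j : Fin n} (hj : 0 < a j)
    (hzj : 0 < z j) : b / gradCoord K f j (fun _ => M) ≤ velocity K f a b z j := by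
  unfold velocity
  rw [if_pos hj]
  exact div_le_div₀ (add_nonneg (mul_nonneg hj.le hzj.le) hb)
    (le_add_of_nonneg_left (mul_nonneg hj.le hzj.le)) (hpos z hz j hzj)
    (hf.grad_mono_of_nonneg hz hzM j)

lemma norm_velocity_le (hf : IsCostFunction K f)
    (hpos : ∀ z : Fin n → ℝ, 0 ≤ z → ∀ j, 0 < z j → 0 < gradCoord K f j z) (hs : 0 ≤ s)
    (ha : ∀ j, 0 ≤ a j) (hb : 0 ≤ b) (hM : ∀ j, s j + 1 ≤ M) {z : Fin n → ℝ} (hsz : s ≤ z)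
    (hzM : ∀ j, z j ≤ M) {η : Fin n → ℝ} (hη : ∀ j, 0 < a j → 0 < η j ∧ s j + η j ≤ z j) :
    ‖velocity K f a b z‖ ≤ ∑ j, |velocityBound K f a s b M j (η j)| := by
  refine (pi_norm_le_iff_of_nonneg (Finset.sum_nonneg fun j _ => abs_nonneg _)).2 fun j => ?_
  refine le_trans ?_ (Finset.single_le_sum
    (f := fun j => |velocityBound K f a s b M j (η j)|) (fun j _ => abs_nonneg _) (Finset.mem_univ j))
  rw [Real.norm_of_nonneg (velocity_nonneg hf ha hb (hs.trans hsz) j)]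
  by_cases hj : 0 < a j
  · exact (velocity_le hf hpos hs ha hb hM hsz (hzM j) (hη j hj).1 fun _ => (hη j hj).2).trans
      (le_abs_self _)
  · rw [velocity, if_neg hj]
    exact abs_nonneg _

/-- Trajectories of the velocity field, started slightly above `s` in the active coordinates. -/
lemma exists_perturbed_trajectory (hf : IsCostFunction K f)
    (hpos : ∀ z : Fin n → ℝ, 0 ≤ z → ∀ j, 0 < z j → 0 < gradCoord K f j z) (hs : 0 ≤ s)
    (ha : ∀ j, 0 ≤ a j) (hb : 0 < b) (hM : ∀ j, s j + 1 ≤ M) {ε : ℝ} (hε : 0 < ε) (hε1 : ε ≤ 1) :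
    ∃ X : ℝ → Fin n → ℝ,
      (∀ τ, 0 < τ → HasDerivAt X (velocity K f a b (boxProj a s M 0 (X τ))) τ) ∧
      (∀ τ, 0 ≤ τ → s ≤ X τ) ∧
      (∀ τ, 0 ≤ τ → ∀ j, 0 < a j → s j + b / gradCoord K f j (fun _ => M) * τ ≤ X τ j) ∧
      (∀ τ, 0 ≤ τ → ∀ j, ∀ η, ε ≤ η → η ≤ 1 →
        X τ j ≤ s j + η + velocityBound K f a s b M j η * τ) ∧
      ∀ τ, 0 ≤ τ → ∀ j, ¬ 0 < a j → X τ j = s j := by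
  have hbox : ∀ u : Fin n → ℝ, ∀ j, 0 < a j → s j + ε ≤ boxProj a s M ε u j := fun u j hj => by
    rw [boxProj, if_pos hj]; exact le_max_left _ _
  have hbox0 : ∀ u : Fin n → ℝ, ∀ j, 0 < a j → 0 < boxProj a s M ε u j := fun u j hj =>
    (add_pos_of_nonneg_of_pos (hs j) hε).trans_le (hbox u j hj)
  have hnn : ∀ u : Fin n → ℝ, 0 ≤ boxProj a s M ε u := fun u => hs.trans (le_boxProj hε.le u)
  obtain ⟨X, hX0, hXc, hXd⟩ := exists_hasDerivAt_of_continuous_of_bounded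
    (F := fun u => velocity K f a b (boxProj a s M ε u))
    (continuous_iff_continuousAt.2 fun u =>
      continuousAt_velocity hf hpos hs hε.le (hbox0 u))
    (fun u => norm_velocity_le hf hpos hs ha hb.le hM (le_boxProj hε.le u) (boxProj_le hM hε1 u)
      (η := fun _ => ε) fun j hj => ⟨hε, hbox u j hj⟩)
    (fun j => if 0 < a j then s j + ε else s j)
  have hX0 : ∀ j, X 0 j = if 0 < a j then s j + ε else s j := fun j => congrFun hX0 j
  have hXcj : ∀ j, ∀ σ τ : ℝ, 0 ≤ σ → ContinuousOn (fun r => X r j) (Icc σ τ) := fun j σ τ hσ =>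
    (continuous_apply j).comp_continuousOn (hXc.mono fun r hr => hσ.trans hr.1)
  have hXdj : ∀ j, ∀ τ, 0 < τ → HasDerivAt (fun r => X r j)
      (velocity K f a b (boxProj a s M ε (X τ)) j) τ := fun j τ hτ => hasDerivAt_pi.1 (hXd τ hτ) j
  have hinact : ∀ τ, 0 ≤ τ → ∀ j, ¬ 0 < a j → X τ j = s j := by
    intro τ hτ j hj
    have := increment_mem_Icc_of_hasDerivAt (lo := 0) (hi := 0) hτ (hXcj j 0 τ le_rfl)
      (fun r hr => hXdj j r hr.1) (fun r _ => by simp [velocity, hj])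
      (fun r _ => by simp [velocity, hj])
    rw [zero_mul, Icc_self, mem_singleton_iff, hX0, if_neg hj] at this
    linarith
  have hc0 : ∀ j, 0 ≤ b / gradCoord K f j (fun _ => M) := fun j =>
    div_nonneg hb.le (hf.grad_nonneg (fun i => by
      have := hM i; have := hs i; simp only [Pi.zero_apply] at this ⊢; linarith) j)
  have hact : ∀ τ, 0 ≤ τ → ∀ j, 0 < a j →
      s j + ε + b / gradCoord K f j (fun _ => M) * τ ≤ X τ j := by
    intro τ hτ j hj
    have := (increment_mem_Icc_of_hasDerivAt (lo := b / gradCoord K f j (fun _ => M)) hτ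
      (hXcj j 0 τ le_rfl) (fun r hr => hXdj j r hr.1)
      (fun r _ => le_velocity hf hpos hb.le (hnn _) (boxProj_le hM hε1 _) hj (hbox0 _ j hj))
      (fun r _ => velocity_le hf hpos hs ha hb.le hM (le_boxProj hε.le _) (boxProj_le hM hε1 _ j)
        hε (fun _ => hbox _ j hj))).1
    rw [hX0, if_pos hj] at this
    linarith
  have hact' : ∀ τ, 0 ≤ τ → ∀ j, 0 < a j → s j + ε ≤ X τ j := fun τ hτ j hj =>
    (le_add_of_nonneg_right (mul_nonneg (hc0 j) hτ)).trans (hact τ hτ j hj)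
  refine ⟨X, fun τ hτ => ?_, fun τ hτ j => ?_, fun τ hτ j hj => ?_, fun τ hτ j η hη hη1 => ?_,
    hinact⟩
  · have hproj : boxProj a s M 0 (X τ) = boxProj a s M ε (X τ) := by
      funext j
      unfold boxProj
      split_ifs with hj
      · have h1 := hact' τ hτ.le j hj
        have h2 : s j + ε ≤ min (X τ j) M := le_min h1 (by have := hM j; linarith)
        rw [max_eq_right h2, max_eq_right (by linarith)]
      · rfl
    rw [hproj]
    exact hXd τ hτ
  · by_cases hj : 0 < a j
    · exact (le_add_of_nonneg_right hε.le).trans (hact' τ hτ j hj)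
    · exact (hinact τ hτ j hj).ge
  · exact (hact τ hτ j hj).trans' (by linarith)
  · have hη0 : 0 < η := hε.trans_le hη
    have hB := velocityBound_nonneg hf hs ha hb.le hM j hη0.le
    have hBτ := mul_nonneg hB hτ
    by_cases hj : 0 < a j
    · rcases le_or_gt (X τ j) (s j + η) with h | h
      · linarith
      -- From a time `σ` at which the level `s j + η` is attained, the coordinate stays above it by
      -- monotonicity, and its speed is bounded in terms of `η` alone. The start lies below that
      -- level because `ε ≤ η`.
      · obtain ⟨σ, hσ, hσj⟩ := intermediate_value_Icc hτ (hXcj j 0 τ le_rfl)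
          (show s j + η ∈ Icc (X 0 j) (X τ j) from ⟨by rw [hX0, if_pos hj]; linarith, h.le⟩)
        have hmono : MonotoneOn (fun r => X r j) (Icc σ τ) :=
          monotoneOn_Icc_of_hasDerivAt_nonneg (hXcj j σ τ hσ.1)
            (fun r hr => hXdj j r (hσ.1.trans_lt hr.1))
            fun r _ => velocity_nonneg hf ha hb.le (hnn _) j
        have := (increment_mem_Icc_of_hasDerivAt (lo := 0) (hi := velocityBound K f a s b M j η)
          hσ.2 (hXcj j σ τ hσ.1)
          (fun r hr => hXdj j r (hσ.1.trans_lt hr.1))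
          (fun r _ => velocity_nonneg hf ha hb.le (hnn _) j)
          (fun r hr => velocity_le hf hpos hs ha hb.le hM (le_boxProj hε.le _)
            (boxProj_le hM hε1 _ j) hη0 fun _ => by
              have h1 : s j + η ≤ X r j := by
                have := hmono (left_mem_Icc.2 hσ.2) (Ioo_subset_Icc_self hr) hr.1.le
                simp only [hσj] at this
                exact this
              rw [boxProj, if_pos hj]
              exact le_max_of_le_right (le_min h1 (by have := hM j; linarith)))).2
        have h3 : velocityBound K f a s b M j η * (τ - σ) ≤ velocityBound K f a s b M j η * τ :=
          mul_le_mul_of_nonneg_left (by linarith [hσ.1]) hB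
        simp only at hσj
        rw [hσj] at this
        linarith
    · rw [hinact τ hτ j hj]
      linarith

/-- A trajectory of the velocity field that starts at `s`, where the velocity may be infinite. -/
lemma exists_trajectory (hf : IsCostFunction K f)
    (hpos : ∀ z : Fin n → ℝ, 0 ≤ z → ∀ j, 0 < z j → 0 < gradCoord K f j z) (hs : 0 ≤ s)
    (ha : ∀ j, 0 ≤ a j) (hb : 0 < b) (hM : ∀ j, s j + 1 ≤ M) :
    ∃ x : ℝ → Fin n → ℝ, x 0 = s ∧ ContinuousOn x (Ici 0) ∧
      (∀ τ, 0 < τ → HasDerivAt x (velocity K f a b (boxProj a s M 0 (x τ))) τ) ∧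
      (∀ τ, 0 ≤ τ → ∀ j, 0 < a j → s j + b / gradCoord K f j (fun _ => M) * τ ≤ x τ j) ∧
      (∀ τ, 0 ≤ τ → ∀ j, ¬ 0 < a j → x τ j = s j) := by
  set U : Ultrafilter ℕ := hyperfilter ℕ
  have hU : (U : Filter ℕ) ≤ atTop := Nat.hyperfilter_le_atTop
  have hεlim : Tendsto (fun k : ℕ => 1 / ((k : ℝ) + 1)) U (𝓝 0) :=
    tendsto_one_div_add_atTop_nhds_zero_nat.mono_left hU
  have hε1 : ∀ k : ℕ, 1 / ((k : ℝ) + 1) ≤ 1 := fun k => by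
    rw [div_le_one (by positivity)]; linarith [Nat.cast_nonneg' k (α := ℝ)]
  choose X hXd hXs hXlo hXhi hXin using fun k : ℕ =>
    exists_perturbed_trajectory hf hpos hs ha hb hM
      (ε := 1 / ((k : ℝ) + 1)) (by positivity) (hε1 k)
  have hex : ∀ τ, ∃ p, 0 ≤ τ → Tendsto (fun k => X k τ) U (𝓝 p) := by
    intro τ
    by_cases hτ : 0 ≤ τ
    · obtain ⟨p, -, hp⟩ := (isCompact_Icc (a := s)
        (b := fun j => s j + 1 + velocityBound K f a s b M j 1 * τ)).ultrafilter_le_nhds'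
        (U.map fun k => X k τ) (Ultrafilter.mem_map.2 (Filter.univ_mem' fun k =>
          ⟨hXs k τ hτ, fun j => hXhi k τ hτ j 1 (hε1 k) le_rfl⟩))
      exact ⟨p, fun _ => hp⟩
    · exact ⟨0, fun h => absurd h hτ⟩
  choose x hx using hex
  have hxj : ∀ τ, 0 ≤ τ → ∀ j, Tendsto (fun k => X k τ j) U (𝓝 (x τ j)) := fun τ hτ j =>
    tendsto_pi_nhds.1 (hx τ hτ) j
  have hxs : ∀ τ, 0 ≤ τ → s ≤ x τ := fun τ hτ j =>
    ge_of_tendsto (hxj τ hτ j) (.of_forall fun k => hXs k τ hτ j)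
  have hxlo : ∀ τ, 0 ≤ τ → ∀ j, 0 < a j → s j + b / gradCoord K f j (fun _ => M) * τ ≤ x τ j :=
    fun τ hτ j hj => ge_of_tendsto (hxj τ hτ j) (.of_forall fun k => hXlo k τ hτ j hj)
  -- Each fixed `η` eventually exceeds `ε`, so in the limit the bound holds for every `η` in `(0,
  -- 1]`; it yields the initial value and right-continuity at `0`.
  have hxhi : ∀ τ, 0 ≤ τ → ∀ j, ∀ η, 0 < η → η ≤ 1 →
      x τ j ≤ s j + η + velocityBound K f a s b M j η * τ := fun τ hτ j η hη hη1 => by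
    refine le_of_tendsto (hxj τ hτ j) ?_
    filter_upwards [hεlim.eventually (gt_mem_nhds hη)] with k hk
    exact hXhi k τ hτ j η hk.le hη1
  have hxin : ∀ τ, 0 ≤ τ → ∀ j, ¬ 0 < a j → x τ j = s j := fun τ hτ j hj =>
    tendsto_nhds_unique (hxj τ hτ j)
      (tendsto_const_nhds.congr fun k => (hXin k τ hτ j hj).symm)
  have hM0 : ∀ j, 0 < M := fun j => by
    have := hM j; have := hs j; simp only [Pi.zero_apply] at this; linarith
  have hc : ∀ j, 0 < b / gradCoord K f j (fun _ => M) := fun j =>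
    div_pos hb (hpos _ (fun i => (hM0 i).le) j (hM0 j))
  have hbox : ∀ τ₁, 0 < τ₁ → ∀ u : Fin n → ℝ, ∀ j,
      s j + b / gradCoord K f j (fun _ => M) * τ₁ ≤ u j → 0 < a j →
      s j + min (b / gradCoord K f j (fun _ => M) * τ₁) 1 ≤ boxProj a s M 0 u j := by
    intro τ₁ _ u j hu hj
    rw [boxProj, if_pos hj]
    refine le_max_of_le_right (le_min ?_ ?_)
    · exact hu.trans' (by gcongr; exact min_le_left _ _)
    · exact (hM j).trans' (by gcongr; exact min_le_right _ _)
  have hder : ∀ τ, 0 < τ → HasDerivAt x (velocity K f a b (boxProj a s M 0 (x τ))) τ := by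
    intro τ₀ hτ₀
    refine hasDerivAt_of_tendsto_of_increments (U := (U : Filter ℕ)) (X := X) ?_ ?_
    · filter_upwards [lt_mem_nhds hτ₀] with τ hτ using hx τ hτ.le
    intro η hη
    refine ⟨fun _ => 0, tendsto_const_nhds, ?_⟩
    have hpb : ∀ j, 0 < a j → 0 < boxProj a s M 0 (x τ₀) j := fun j hj =>
      (hbox τ₀ hτ₀ _ j (hxlo τ₀ hτ₀.le j hj) hj).trans_lt'
        (add_pos_of_nonneg_of_pos (hs j) (lt_min (mul_pos (hc j) hτ₀) one_pos))
    obtain ⟨r, hr, hFr⟩ := Metric.continuousAt_iff.1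
      (continuousAt_velocity (b := b) hf hpos hs le_rfl hpb) η hη
    -- From time `τ₀ / 2` on, the active coordinates exceed `s` by a fixed amount, so the speeds are
    -- bounded uniformly in `k` despite the singularity at the start.
    set Λ := ∑ j, |velocityBound K f a s b M j
      (min (b / gradCoord K f j (fun _ => M) * (τ₀ / 2)) 1)| with hΛ
    have hΛ0 : 0 ≤ Λ := Finset.sum_nonneg fun j _ => abs_nonneg _
    have hvel : ∀ k τ, τ₀ / 2 ≤ τ → ‖velocity K f a b (boxProj a s M 0 (X k τ))‖ ≤ Λ := by
      intro k τ hτ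
      refine norm_velocity_le hf hpos hs ha hb.le hM (le_boxProj le_rfl _)
        (boxProj_le hM zero_le_one _) fun j hj =>
          ⟨lt_min (mul_pos (hc j) (half_pos hτ₀)) one_pos, hbox _ (half_pos hτ₀) _ j ?_ hj⟩
      refine (hXlo k τ ((half_pos hτ₀).le.trans hτ) j hj).trans' ?_
      have := hc j
      gcongr
    have h1 : ∀ᶠ τ in 𝓝 τ₀, Λ * |τ - τ₀| < r / 2 := by
      have : Tendsto (fun τ => Λ * |τ - τ₀|) (𝓝 τ₀) (𝓝 (Λ * |τ₀ - τ₀|)) :=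
        (continuous_const.mul (continuous_id.sub continuous_const).abs).tendsto τ₀
      rw [sub_self, abs_zero, mul_zero] at this
      exact this.eventually (gt_mem_nhds (half_pos hr))
    have h2 : ∀ᶠ k in (U : Filter ℕ), ‖X k τ₀ - x τ₀‖ < r / 2 := by
      have : Tendsto (fun k => ‖X k τ₀ - x τ₀‖) U (𝓝 ‖x τ₀ - x τ₀‖) :=
        ((hx τ₀ hτ₀.le).sub_const _).norm
      rw [sub_self, norm_zero] at this
      exact this.eventually (gt_mem_nhds (half_pos hr))
    filter_upwards [h1, lt_mem_nhds (half_lt_self hτ₀)] with τ hτ hτ2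
    filter_upwards [h2] with k hk
    have hsub : ∀ σ ∈ uIcc τ₀ τ, τ₀ / 2 ≤ σ := fun σ hσ =>
      (le_inf (half_lt_self hτ₀).le hτ2.le).trans hσ.1
    have hdk : ∀ σ ∈ uIcc τ₀ τ,
        HasDerivWithinAt (X k) (velocity K f a b (boxProj a s M 0 (X k σ))) (uIcc τ₀ τ) σ :=
      fun σ hσ => (hXd k σ ((half_pos hτ₀).trans_le (hsub σ hσ))).hasDerivWithinAt
    have hnear : ∀ σ ∈ uIcc τ₀ τ, ‖velocity K f a b (boxProj a s M 0 (X k σ))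
        - velocity K f a b (boxProj a s M 0 (x τ₀))‖ ≤ η := by
      intro σ hσ
      rw [← dist_eq_norm]
      refine (hFr ?_).le
      rw [dist_eq_norm]
      have h3 := (convex_uIcc τ₀ τ).norm_image_sub_le_of_norm_hasDerivWithin_le hdk
        (fun σ hσ => hvel k σ (hsub σ hσ)) left_mem_uIcc hσ
      have h4 : Λ * ‖σ - τ₀‖ ≤ Λ * |τ - τ₀| :=
        mul_le_mul_of_nonneg_left (abs_sub_left_of_mem_uIcc hσ) hΛ0
      calc ‖X k σ - x τ₀‖ ≤ ‖X k σ - X k τ₀‖ + ‖X k τ₀ - x τ₀‖ :=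
            norm_sub_le_norm_sub_add_norm_sub _ _ _
        _ < r := by linarith
    have h5 := (convex_uIcc τ₀ τ).norm_image_sub_le_of_norm_hasDerivWithin_le
      (f := fun σ => X k σ - σ • velocity K f a b (boxProj a s M 0 (x τ₀)))
      (fun σ hσ => (hdk σ hσ).sub (((hasDerivAt_id σ).smul_const _).hasDerivWithinAt))
      (fun σ hσ => by simpa using hnear σ hσ) left_mem_uIcc (right_mem_uIcc (a := τ₀) (b := τ))
    rw [add_zero]
    refine le_of_eq_of_le ?_ h5
    rw [sub_smul]
    congr 1
    abel
  have hx0 : x 0 = s := by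
    refine le_antisymm (fun j => le_of_forall_pos_le_add fun η hη => ?_) (hxs 0 le_rfl)
    have := hxhi 0 le_rfl j (min η 1) (lt_min hη one_pos) (min_le_right _ _)
    rw [mul_zero, add_zero] at this
    exact this.trans (by gcongr; exact min_le_left _ _)
  refine ⟨x, hx0, fun τ hτ => ?_, hder, hxlo, hxin⟩
  rcases (mem_Ici.1 hτ).eq_or_lt with rfl | hτ
  · rw [ContinuousWithinAt, hx0]
    refine tendsto_pi_nhds.2 fun j => tendsto_order.2 ⟨fun q hq => ?_, fun q hq => ?_⟩
    · filter_upwards [self_mem_nhdsWithin] with τ hτ using hq.trans_le (hxs τ hτ j)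
    · have hη : 0 < min ((q - s j) / 2) 1 := lt_min (half_pos (sub_pos.2 hq)) one_pos
      have hlim : Tendsto (fun τ => s j + min ((q - s j) / 2) 1
          + velocityBound K f a s b M j (min ((q - s j) / 2) 1) * τ) (𝓝[≥] 0)
          (𝓝 (s j + min ((q - s j) / 2) 1
          + velocityBound K f a s b M j (min ((q - s j) / 2) 1) * 0)) :=
        (continuous_const.add (continuous_const.mul continuous_id)).continuousWithinAt
      have hlt : s j + min ((q - s j) / 2) 1
          + velocityBound K f a s b M j (min ((q - s j) / 2) 1) * 0 < q := by
        have := min_le_left ((q - s j) / 2) 1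
        linarith
      filter_upwards [self_mem_nhdsWithin, hlim.eventually (gt_mem_nhds hlt)] with τ hτ h
      exact (hxhi τ hτ j _ hη (min_le_right _ _)).trans_lt h
  · exact (hder τ hτ).continuousAt.continuousWithinAt

end Velocity

/-! ### Integrability of the dual rate and existence of executions -/

open MeasureTheory in
-- The index type varies with `σ` but takes only finitely many values, so the map factors through
-- pairs of an index set and a point, and is measurable for each fixed index set.
lemma measurable_iInf_subtype {α ι : Type*} [MeasurableSpace α] [Finite ι] {p : ι → α → Prop}
    (hp : ∀ ℓ, MeasurableSet {σ | p ℓ σ}) {q : ι → α → ℝ} (hq : ∀ ℓ, Measurable (q ℓ)) :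
    Measurable fun σ => ⨅ ℓ : {ℓ // p ℓ σ}, q ℓ σ := by
  have h1 : Measurable fun r : Set ι × α => ⨅ ℓ : r.1, q ℓ r.2 :=
    measurable_from_prod_countable_right fun S =>
      Measurable.iInf (f := fun (ℓ : S) σ => q ℓ σ) fun ℓ => hq ℓ
  have h2 : Measurable fun σ => ({ℓ | p ℓ σ} : Set ι) :=
    measurable_set_iff.2 fun ℓ => measurableSet_setOfPred.1 (hp ℓ)
  exact h1.comp (h2.prodMk measurable_id)

/-- Along a monotone trajectory each partial derivative is monotone in time, hence measurable, even
where it might be discontinuous. -/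
lemma measurable_dualRate_comp {n : ℕ} {K : Set (Fin n → ℝ)} {f : (Fin n → ℝ) → ℝ}
    (hf : IsCostFunction K f) {d : ℕ} {ρ δ : ℝ} (hδ : 0 < δ) {u : ℝ → Fin n → ℝ}
    (hu : Monotone u) (hu0 : ∀ σ, 0 ≤ u σ) : Measurable fun σ => dualRate K f d ρ δ (u σ) := by
  have h1 : ∀ ℓ, Measurable fun σ => gradCoord K f ℓ (u σ) := fun ℓ =>
    Monotone.measurable fun a b hab => hf.grad_mono_of_nonneg (hu0 a) (hu hab) ℓ
  have h2 : ∀ ℓ, Measurable fun σ => gradCoord K f ℓ (δ • u σ) := fun ℓ =>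
    Monotone.measurable fun a b hab => hf.grad_mono_of_nonneg (smul_nonneg hδ.le (hu0 a))
      (smul_le_smul_of_nonneg_left (hu hab) hδ.le) ℓ
  exact (measurable_iInf_subtype (fun ℓ => measurableSet_lt measurable_const (h1 ℓ))
    fun ℓ => (h2 ℓ).div (h1 ℓ)).div_const _

/-- A new row can be processed from every nonnegative primal point. -/
lemma exists_isRound {n m : ℕ} {K : Set (Fin n → ℝ)} {f : (Fin n → ℝ) → ℝ}
    (hf : IsCostFunction K f)
    (hpos : ∀ z : Fin n → ℝ, 0 ≤ z → ∀ j, 0 < z j → 0 < gradCoord K f j z)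
    {d : ℕ} {ρ δ : ℝ} (hδ : 0 < δ) {A : Matrix (Fin m) (Fin n) ℝ} (hA : IsInstance A d ρ)
    (t : Fin m) (T₀ : ℝ) {s : Fin n → ℝ} (hs : 0 ≤ s) (y₀ : Fin m → ℝ) :
    ∃ (e : ℝ) (x : ℝ → Fin n → ℝ) (y : ℝ → Fin m → ℝ),
      IsRound K f A d ρ δ t T₀ e x y ∧ x T₀ = s ∧ y T₀ = y₀ := by
  by_cases hsat : 1 ≤ ∑ j, A t j * s j
  · refine ⟨T₀, fun _ => s, fun _ => y₀, ⟨le_rfl, fun τ hτ => ?_, hsat, continuousOn_const,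
      fun τ hτ => ?_, fun τ hτ => ?_, fun _ _ _ _ => rfl, IntervalIntegrable.refl, fun τ hτ => ?_,
      fun _ _ _ _ => rfl⟩, rfl, rfl⟩
    · simp at hτ
    · simp at hτ
    · simp at hτ
    · rw [le_antisymm hτ.2 hτ.1]; simp
  have hd : (0 : ℝ) < d := by exact_mod_cast hA.one_le_d t
  have hb : (0 : ℝ) < 1 / d := one_div_pos.2 hd
  have hL := hA.log_pos t
  -- With `M ≥ 1 / A t j` the truncation at `M` is inactive as long as the row is unsatisfied.
  obtain ⟨M, hM, hM'⟩ : ∃ M, (∀ j, s j + 1 ≤ M) ∧ ∀ j, (A t j)⁻¹ ≤ M := by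
    have hle : ∀ j, s j + 1 + (A t j)⁻¹ ≤ ∑ i, (s i + 1 + (A t i)⁻¹) := fun j =>
      Finset.single_le_sum (f := fun i => s i + 1 + (A t i)⁻¹)
        (fun i _ => add_nonneg (add_nonneg (hs i) zero_le_one) (inv_nonneg.2 (hA.nonneg t i)))
        (Finset.mem_univ j)
    refine ⟨_, fun j => (le_add_of_nonneg_right (inv_nonneg.2 (hA.nonneg t j))).trans (hle j),
      fun j => (le_add_of_nonneg_left (add_nonneg (hs j) zero_le_one)).trans (hle j)⟩
  obtain ⟨ξ, hξ0, hξc, hξd, hξlo, hξin⟩ := exists_trajectory hf hpos hs (hA.nonneg t) hb hM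
  obtain ⟨j₀, hj₀⟩ := hA.satisfiable t
  have hM0 : 0 < M := (inv_pos.2 hj₀).trans_le (hM' j₀)
  have hc : ∀ j, 0 < 1 / (d : ℝ) / gradCoord K f j (fun _ => M) := fun j =>
    div_pos hb (hpos _ (fun i => hM0.le) j hM0)
  have hξs : ∀ τ, 0 ≤ τ → s ≤ ξ τ := fun τ hτ j => by
    by_cases hj : 0 < A t j
    · exact (hξlo τ hτ j hj).trans' (le_add_of_nonneg_right (mul_nonneg (hc j).le hτ))
    · exact (hξin τ hτ j hj).ge
  have hξn : ∀ τ, 0 ≤ τ → 0 ≤ ξ τ := fun τ hτ => hs.trans (hξs τ hτ)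
  have hξcj : ∀ j, ContinuousOn (fun r => ξ r j) (Ici 0) := fun j =>
    (continuous_apply j).comp_continuousOn hξc
  have hξmono : MonotoneOn ξ (Ici 0) := fun p hp q hq hpq j => by
    refine monotoneOn_Icc_of_hasDerivAt_nonneg (u := fun r => ξ r j)
      ((hξcj j).mono fun r hr => (mem_Ici.1 hp).trans hr.1)
      (fun r hr => hasDerivAt_pi.1 (hξd r ((mem_Ici.1 hp).trans_lt hr.1)) j)
      (fun r _ => velocity_nonneg hf (hA.nonneg t) hb.le (hs.trans (le_boxProj le_rfl _)) j)
      (left_mem_Icc.2 hpq) (right_mem_Icc.2 hpq) hpq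
  have hloadc : ContinuousOn (fun r => ∑ j, A t j * ξ r j) (Ici 0) :=
    continuousOn_finsetSum _ fun j _ => continuousOn_const.mul (hξcj j)
  -- The round ends at the first time the row is satisfied; such a time exists because `ξ j₀` grows
  -- at least linearly.
  obtain ⟨ℓ, ⟨⟨hℓ0, hℓ1⟩, hℓmin⟩⟩ : ∃ ℓ, IsLeast {r : ℝ | 0 ≤ r ∧ 1 ≤ ∑ j, A t j * ξ r j} ℓ := by
    set c := 1 / (d : ℝ) / gradCoord K f j₀ (fun _ => M) with hcdef
    have hcj : 0 < c := hc j₀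
    have hr1 : 0 ≤ 1 / (A t j₀ * c) := by positivity
    have hcl : IsClosed {r : ℝ | 0 ≤ r ∧ 1 ≤ ∑ j, A t j * ξ r j} :=
      hloadc.preimage_isClosed_of_isClosed isClosed_Ici isClosed_Ici
    refine ⟨_, hcl.isLeast_csInf ?_ ⟨0, fun r hr => hr.1⟩⟩
    refine ⟨1 / (A t j₀ * c), hr1, ?_⟩
    refine le_trans ?_ (Finset.single_le_sum (f := fun j => A t j * ξ (1 / (A t j₀ * c)) j)
      (fun j _ => mul_nonneg (hA.nonneg t j) (hξn _ hr1 j)) (Finset.mem_univ j₀))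
    calc (1 : ℝ) = A t j₀ * (c * (1 / (A t j₀ * c))) := by field_simp
      _ ≤ A t j₀ * ξ (1 / (A t j₀ * c)) j₀ :=
        mul_le_mul_of_nonneg_left ((hξlo _ hr1 j₀ hj₀).trans' (le_add_of_nonneg_left (hs j₀)))
          hj₀.le
  have hunsat : ∀ r, 0 ≤ r → r < ℓ → ∑ j, A t j * ξ r j < 1 := fun r hr hrℓ =>
    not_le.1 fun h => absurd (hℓmin ⟨hr, h⟩) (not_le.2 hrℓ)
  have hgrad : ∀ r, 0 < r → ∀ j, 0 < A t j → 0 < gradCoord K f j (ξ r) := fun r hr j hj =>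
    hpos _ (hξn r hr.le) j ((add_pos_of_nonneg_of_pos (hs j) (mul_pos (hc j) hr)).trans_le
      (hξlo r hr.le j hj))
  have hle : ∀ r, 0 ≤ r → r < ℓ → ∀ j, 0 < A t j → ξ r j ≤ M := fun r hr hrℓ j hj => by
    refine le_trans ?_ (hM' j)
    rw [← one_div, le_div_iff₀' hj]
    exact (Finset.single_le_sum (f := fun j => A t j * ξ r j)
      (fun j _ => mul_nonneg (hA.nonneg t j) (hξn r hr j)) (Finset.mem_univ j)).trans
      (hunsat r hr hrℓ).le
  have hproj : ∀ r, 0 ≤ r → r < ℓ → boxProj (A t) s M 0 (ξ r) = ξ r := fun r hr hrℓ => by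
    funext j
    unfold boxProj
    split_ifs with hj
    · rw [min_eq_left (hle r hr hrℓ j hj), add_zero, max_eq_right (hξs r hr j)]
    · exact (hξin r hr j hj).symm
  have hrate : ∀ r ∈ Ioo 0 ℓ, ∀ j, 0 < A t j →
      HasDerivAt (fun σ => ξ σ j) ((A t j * ξ r j + 1 / d) / gradCoord K f j (ξ r)) r := by
    intro r hr j hj
    have := hasDerivAt_pi.1 (hξd r hr.1) j
    rwa [hproj r hr.1.le hr.2, velocity, if_pos hj] at this
  -- The dual rate is dominated by a constant times the rate of `ξ j₀`, whose numerator is at least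
  -- `1 / d`. That rate is integrable as the nonnegative derivative of a continuous function.
  have hint : MeasureTheory.IntegrableOn (fun r => dualRate K f d ρ δ (ξ r)) (Ioo 0 ℓ) := by
    have hvel : MeasureTheory.IntegrableOn
        (fun r => (A t j₀ * ξ r j₀ + 1 / d) / gradCoord K f j₀ (ξ r)) (Ioo 0 ℓ) :=
      (intervalIntegral.integrableOn_deriv_of_nonneg (g := fun r => ξ r j₀)
        ((hξcj j₀).mono fun r hr => hr.1) (fun r hr => hrate r hr j₀ hj₀) fun r hr =>
          div_nonneg (add_nonneg (mul_nonneg hj₀.le (hξn r hr.1.le j₀)) hb.le)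
            (hgrad r hr.1 j₀ hj₀).le).mono_set Ioo_subset_Ioc_self
    have hmeas : Measurable fun r => dualRate K f d ρ δ (ξ (max r 0)) :=
      measurable_dualRate_comp hf hδ
        (fun p q hpq => hξmono (le_max_right p 0) (le_max_right q 0) (max_le_max_right 0 hpq))
        fun r => hξn _ (le_max_right r 0)
    have hcongr : ∀ r ∈ Ioo 0 ℓ, dualRate K f d ρ δ (ξ (max r 0)) = dualRate K f d ρ δ (ξ r) :=
      fun r hr => by rw [max_eq_left hr.1.le]
    refine MeasureTheory.IntegrableOn.congr_fun ?_ hcongr measurableSet_Ioo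
    refine MeasureTheory.Integrable.mono' (hvel.const_mul
      (gradCoord K f j₀ (δ • ξ ℓ) / Real.log (1 + d * ρ) * d)) hmeas.aestronglyMeasurable ?_
    refine (MeasureTheory.ae_restrict_iff' measurableSet_Ioo).2 (.of_forall fun r hr => ?_)
    have hrn := hξn r hr.1.le
    rw [hcongr r hr, Real.norm_of_nonneg (dualRate_nonneg hf hδ hL hrn)]
    have hg := hgrad r hr.1 j₀ hj₀
    refine (dualRate_le hL hg).trans ?_
    have h1 : gradCoord K f j₀ (δ • ξ r) ≤ gradCoord K f j₀ (δ • ξ ℓ) :=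
      hf.grad_mono_of_nonneg (smul_nonneg hδ.le hrn)
        (smul_le_smul_of_nonneg_left (hξmono hr.1.le hℓ0 hr.2.le) hδ.le) j₀
    have h0 := hf.grad_nonneg (smul_nonneg hδ.le hrn) j₀
    have h2 : (1 : ℝ) ≤ d * (A t j₀ * ξ r j₀ + 1 / d) := by
      rw [mul_add, mul_one_div_cancel hd.ne']
      exact le_add_of_nonneg_left (mul_nonneg hd.le (mul_nonneg hj₀.le (hrn j₀)))
    calc gradCoord K f j₀ (δ • ξ r) / Real.log (1 + d * ρ) * (gradCoord K f j₀ (ξ r))⁻¹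
        ≤ gradCoord K f j₀ (δ • ξ ℓ) / Real.log (1 + d * ρ) * (gradCoord K f j₀ (ξ r))⁻¹ := by
          have := inv_pos.2 hg
          gcongr
      _ ≤ gradCoord K f j₀ (δ • ξ ℓ) / Real.log (1 + d * ρ) * (gradCoord K f j₀ (ξ r))⁻¹
            * (d * (A t j₀ * ξ r j₀ + 1 / d)) :=
          le_mul_of_one_le_right (mul_nonneg (div_nonneg (h0.trans h1) hL.le)
            (inv_nonneg.2 hg.le)) h2
      _ = _ := by ring
  have hshift : ∀ τ ∈ Icc T₀ (T₀ + ℓ), 0 ≤ τ - T₀ := fun τ hτ => sub_nonneg.2 hτ.1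
  refine ⟨T₀ + ℓ, fun τ => ξ (τ - T₀), fun τ => Function.update y₀ t
    (y₀ t + ∫ σ in T₀..τ, dualRate K f d ρ δ (ξ (σ - T₀))), ?_, by simp [hξ0], by simp⟩
  refine ⟨by linarith, fun τ hτ => hunsat _ (by linarith [hτ.1]) (by linarith [hτ.2]),
    by simpa using hℓ1, ?_, fun τ hτ j hj => hgrad _ (by linarith [hτ.1]) j hj,
    fun τ hτ j hj => ?_, fun τ hτ j hj => ?_, ?_, fun τ hτ => by simp,
    fun τ hτ i hi => by simp [hi]⟩
  · exact hξc.comp (continuousOn_id.sub continuousOn_const) hshift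
  · exact HasDerivAt.comp_sub_const τ T₀
      (hrate (τ - T₀) ⟨by linarith [hτ.1], by linarith [hτ.2]⟩ j hj)
  · have hj' : ¬ 0 < A t j := by rw [hj]; exact lt_irrefl 0
    simp only [hξin _ (hshift τ hτ) j hj', sub_self, hξin 0 le_rfl j hj']
  · have := ((intervalIntegrable_iff_integrableOn_Ioo_of_le hℓ0).2 hint).comp_sub_right T₀
    simpa [add_comm] using this

/-- Every execution can be carried on when a new row arrives. -/
lemma IsRun.exists_extension {n m : ℕ} {K : Set (Fin n → ℝ)} {f : (Fin n → ℝ) → ℝ}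
    (hf : IsCostFunction K f)
    (hpos : ∀ z : Fin n → ℝ, 0 ≤ z → ∀ j, 0 < z j → 0 < gradCoord K f j z)
    {d : ℕ} {ρ δ : ℝ} (hδ : 0 < δ) {A : Matrix (Fin m) (Fin n) ℝ} (hA : IsInstance A d ρ)
    {k : ℕ} (hk : k < m) {T : ℕ → ℝ} {x : ℝ → Fin n → ℝ} {y : ℝ → Fin m → ℝ}
    (h : IsRun K f A d ρ δ k T x y) :
    ∃ (T' : ℕ → ℝ) (x' : ℝ → Fin n → ℝ) (y' : ℝ → Fin m → ℝ),
      IsRun K f A d ρ δ (k + 1) T' x' y' ∧ (∀ i ≤ k, T' i = T i) ∧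
      ∀ τ ∈ Icc 0 (T k), x' τ = x τ ∧ y' τ = y τ := by
  obtain ⟨e, xr, yr, hr, hxr, hyr⟩ := exists_isRound hf hpos hδ hA ⟨k, hk⟩ (T k)
    (h.x_nonneg_time hA hk.le le_rfl) (y (T k))
  have hT : ∀ i ≤ k, Function.update T (k + 1) e i = T i := fun i hi =>
    Function.update_of_ne (by omega) _ _
  have hx : ∀ τ ≤ T k, (if τ ≤ T k then x τ else xr τ) = x τ := fun τ hτ => if_pos hτ
  have hy : ∀ τ ≤ T k, (if τ ≤ T k then y τ else yr τ) = y τ := fun τ hτ => if_pos hτ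
  have h0 : (0 : ℝ) ≤ T k := h.time_nonneg hk.le le_rfl
  refine ⟨Function.update T (k + 1) e, fun τ => if τ ≤ T k then x τ else xr τ,
    fun τ => if τ ≤ T k then y τ else yr τ, ⟨?_, ?_, ?_, fun t ht => ?_⟩, hT,
    fun τ hτ => ⟨hx τ hτ.2, hy τ hτ.2⟩⟩
  · rw [hT 0 (Nat.zero_le k), h.time_zero]
  · rw [hx 0 h0, h.x_zero]
  · rw [hy 0 h0, h.y_zero]
  · rcases Nat.lt_succ_iff_lt_or_eq.1 ht with ht | ht
    · rw [hT t ht.le, hT (t + 1) ht]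
      have hle := h.time_le hk.le (Nat.succ_le_of_lt ht) le_rfl
      exact (h.round t ht).congr (fun τ hτ => hx τ (hτ.2.trans hle))
        fun τ hτ => hy τ (hτ.2.trans hle)
    · obtain rfl : t = ⟨k, hk⟩ := Fin.ext ht
      rw [hT k le_rfl, Function.update_self]
      -- The glued trajectory takes its old value at `T k`, where the new round starts, so the
      -- pieces agree.
      refine hr.congr (fun τ hτ => ?_) fun τ hτ => ?_
      · split_ifs with h'
        · rw [le_antisymm h' hτ.1, hxr]
        · rfl
      · split_ifs with h'
        · rw [le_antisymm h' hτ.1, hyr]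
        · rfl

end

theorem mainTheorem2 {n : ℕ} (K : Set (Fin n → ℝ)) (f : (Fin n → ℝ) → ℝ)
    (hK : ∀ z : Fin n → ℝ, 0 ≤ z → z ∈ K)
    (hconv : ConvexOn ℝ K f)
    (hnonneg : ∀ z ∈ K, 0 ≤ f z)
    (hmono : MonotoneOn f K)
    (hdiff : DifferentiableOn ℝ f K)
    (hgrad : ∀ z ∈ K, ∀ z' ∈ K, z' ≤ z → ∀ j, gradCoord K f j z' ≤ gradCoord K f j z)
    (hzero : f 0 = 0)
    (d : ℕ) (ρ : ℝ) :
    -- every execution keeps `x`, `y`, `μ` non-decreasing and feasible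
    (∀ δ : ℝ, 0 < δ → ∀ (m : ℕ) (A : Matrix (Fin m) (Fin n) ℝ), IsInstance A d ρ →
      ∀ k ≤ m, ∀ (T : ℕ → ℝ) (x : ℝ → Fin n → ℝ) (y : ℝ → Fin m → ℝ),
        IsRun K f A d ρ δ k T x y →
          MonotoneOn x (Icc 0 (T k)) ∧
          MonotoneOn y (Icc 0 (T k)) ∧
          MonotoneOn (fun τ => dualMu K f δ (x τ)) (Icc 0 (T k)) ∧
          (∀ τ ∈ Icc 0 (T k), 0 ≤ x τ) ∧
          (∀ i : Fin m, (i : ℕ) < k → ∀ τ ∈ Icc (T (i + 1)) (T k), 1 ≤ ∑ j, A i j * x τ j) ∧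
          (∀ τ ∈ Icc 0 (T k), DualFeasible A (y τ) (dualMu K f δ (x τ)))) ∧
    -- the algorithm can always be carried on when a new row arrives
    ((∀ z : Fin n → ℝ, 0 ≤ z → ∀ j, 0 < z j → 0 < gradCoord K f j z) →
      ∀ δ : ℝ, 0 < δ → ∀ (m : ℕ) (A : Matrix (Fin m) (Fin n) ℝ), IsInstance A d ρ →
      ∀ k < m, ∀ (T : ℕ → ℝ) (x : ℝ → Fin n → ℝ) (y : ℝ → Fin m → ℝ),
        IsRun K f A d ρ δ k T x y →
          ∃ (T' : ℕ → ℝ) (x' : ℝ → Fin n → ℝ) (y' : ℝ → Fin m → ℝ),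
            IsRun K f A d ρ δ (k + 1) T' x' y' ∧ (∀ i ≤ k, T' i = T i) ∧
            ∀ τ ∈ Icc 0 (T k), x' τ = x τ ∧ y' τ = y τ) ∧
    -- the competitive ratio for each `c`, and its optimization over `c`
    (∀ c : ℝ, 0 < c → IsCompetitive K f d ρ (1 / c) (ratioAt K f d ρ c)) ∧
    (∀ β : EReal, β < (⨆ (c : ℝ) (_ : 0 < c), ratioAt K f d ρ c) →
      ∃ δ : ℝ, 0 < δ ∧ IsCompetitive K f d ρ δ β) := by
  have hf : IsCostFunction K f := ⟨hK, hconv, hnonneg, hmono, hdiff, hgrad, hzero⟩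
  refine ⟨fun δ hδ m A hA k hk T x y h => ?_, fun hpos δ hδ m A hA k hk T x y h =>
    h.exists_extension hf hpos hδ hA hk, fun c hc => isCompetitive_of_le_ratioAt hf hc le_rfl,
    fun β hβ => ?_⟩
  · obtain ⟨h1, h2⟩ := h.x_mono_and_nonneg hA hk
    exact ⟨h1, h.y_mono hf hA hδ hk, h.mu_mono hf hA hδ hk, h2,
      fun i hi τ hτ => h.covered hA hk i hi hτ, fun τ hτ => h.dualFeasible hf hA hδ hk hτ⟩
  · obtain ⟨c, hc⟩ := lt_iSup_iff.1 hβ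
    obtain ⟨hc0, hc⟩ := lt_iSup_iff.1 hc
    exact ⟨1 / c, one_div_pos.2 hc0, isCompetitive_of_le_ratioAt hf hc0 hc.le⟩
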